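/- **Reverse Shannon theorem under Rényi divergence.** Let $\mathcal X,\mathcal Y$ be finite non-empty alphabets and let $\mathcal W:\mathcal X\to\mathcal Y$ be a discrete memoryless channel with transition probabilities $\mathcal W(y|x)$. Write $\mathcal P(\cdot)$ for the set of probability distributions on an alphabet, $\log$ for the logarithm to base $2$, $(P\cdot\mathcal W)(x,y)=P(x)\mathcal W(y|x)$, and $\mathcal W^{\times n}$ for $n$ independent uses of $\mathcal W$. For $\alpha\in[0,\infty]$ the Rényi divergence is $D_\alpha(P\|Q)=-\log F_\alpha(P,Q)\in[0,\infty]$, where $F_\alpha(P,Q)=\big(\sum_x P(x)^\alpha Q(x)^{1-\alpha}\big)^{1/(1-\alpha)}$ for $\alpha\in(0,1)\cup(1,\infty)$ (with $\tfrac00=0$ and $\tfrac a0=\infty$ for $a>0$ when $\alpha>1$), $F_0(P,Q)=\sum_{x:P(x)>0}Q(x)$, $F_1(P,Q)=\prod_{x:P(x)>0}(Q(x)/P(x))^{P(x)}$, and $F_\infty(P,Q)=\min_{x:P(x)>0}Q(x)/P(x)$. The order-$\alpha$ Rényi capacity and the Shannon capacity are $$I_\alpha(\mathcal W)=\max_{P\in\mathcal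 P(\mathcal X)}\ \min_{Q\in\mathcal P(\mathcal Y)}D_\alpha(P\cdot\mathcal W\,\|\,P\times Q),\qquad I(\mathcal W)=\max_{P\in\mathcal P(\mathcal X)}D_1\big(P\cdot\mathcal W\,\|\,P\times \mathcal W(P)\big),$$ where $\mathcal W(P)=\sum_xP(x)\mathcal W(\cdot|x)$ is the output distribution. For $c\ge 0$ let $\mathcal A(\mathcal W,c)$ be the set of channels $\mathcal N:\mathcal X\to\mathcal Y$ of the form $$\mathcal N(y|x)=\sum_{k\in\mathcal K}\sum_{j=1}^{N}P_K(k)\,\mathcal E(j|x,k)\,\mathcal D(y|j,k),$$ where $N\ge1$ is an integer with $\log N\le c$, $P_K$ is a probability distribution (the shared randomness) on a finite alphabet $\mathcal K$ of arbitrary size, and $\mathcal E:\mathcal X\times\mathcal K\to\{1,\dots,N\}$ and $\mathcal D:\{1,\dots,N\}\times\mathcal K\to\mathcal Y$ are stochastic maps. Put $$\mathsf D_\alpha(\mathcal W,c)=\inf_{\mathcal N\in\mathcal A(\mathcal W,c)}\ \max_{P\in\mathcal P(\mathcal X)}D_\alpha(P\cdot\mathcal W\,\|\,P\cdot\mathcal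 N),$$ and define the $\alpha$-Rényi simulation rate, over sequences $(c_n)_{n\ge1}$ of nonnegative reals, by $$R^{(\alpha)}_{\mathrm{RST}}(\mathcal W)=\inf\Big\{\limsup_{n\to\infty}\frac{c_n}{n}\ \Big|\ \limsup_{n\to\infty}\mathsf D_\alpha(\mathcal W^{\times n},c_n)=0\Big\}.$$ Then $$R^{(\alpha)}_{\mathrm{RST}}(\mathcal W)=\begin{cases}I(\mathcal W),&\alpha\in(0,1],\\ I_\alpha(\mathcal W),&\alpha\in\{0\}\cup(1,\infty].\end{cases}$$ -/

import Mathlib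

open scoped ENNReal

noncomputable section

namespace ReverseShannon

/-- The order-`α` fidelity `F_α(P, Q)`, `α ∈ [0, ∞]`, of two nonnegative vectors on a finite
alphabet. In `ℝ≥0∞` we have `0 ^ s = ∞` for `s < 0` and `0 * ∞ = 0`, so that for `α > 1` a letter
with `P x = 0` contributes `0` and a letter with `Q x = 0 < P x` contributes `∞` to the sum.
In the product for `α = 1` a letter with `P x = 0` contributes the factor `1`. -/
def fidelity {A : Type*} [Fintype A] (α : ℝ≥0∞) (P Q : A → ℝ≥0∞) : ℝ≥0∞ :=
  if α = 0 then ∑ x, (Function.support P).indicator Q x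
  else if α = 1 then ∏ x, (Q x / P x) ^ (P x).toReal
  else if α = ∞ then ⨅ x ∈ Function.support P, Q x / P x
  else (∑ x, P x ^ α.toReal * Q x ^ (1 - α.toReal)) ^ (1 / (1 - α.toReal))

/-- The binary logarithm on `[0, ∞]`, with `log₂ 0 = -∞` and `log₂ ∞ = ∞`. -/
def log₂ (x : ℝ≥0∞) : EReal := ENNReal.log x / ((Real.log 2 : ℝ) : EReal)

/-- The order-`α` Rényi divergence `D_α(P ‖ Q) = -log₂ F_α(P, Q)`. -/
def renyiDiv {A : Type*} [Fintype A] (α : ℝ≥0∞) (P Q : A → ℝ≥0∞) : EReal :=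
  -log₂ (fidelity α P Q)

/-- A channel with input alphabet `X` and output alphabet `Y`: `W x y` is the probability
`W(y|x)` of receiving `y` when `x` is sent. -/
abbrev Channel (X Y : Type*) := X → PMF Y

variable {X Y : Type*}

/-- The joint distribution `P · W` of input and output. -/
def joint (P : PMF X) (W : Channel X Y) : X × Y → ℝ≥0∞ := fun p => P p.1 * W p.1 p.2

/-- The product distribution `P × Q`. -/
def prodDist (P : PMF X) (Q : PMF Y) : X × Y → ℝ≥0∞ := fun p => P p.1 * Q p.2

/-- The Rényi mutual information `I_α(X : Y)` of the joint distribution `P · W`. -/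
def renyiMutualInfo [Fintype X] [Fintype Y] (α : ℝ≥0∞) (P : PMF X) (W : Channel X Y) : EReal :=
  ⨅ Q : PMF Y, renyiDiv α (joint P W) (prodDist P Q)

/-- The order-`α` Rényi capacity `I_α(W)`. -/
def renyiCapacity [Fintype X] [Fintype Y] (α : ℝ≥0∞) (W : Channel X Y) : EReal :=
  ⨆ P : PMF X, renyiMutualInfo α P W

/-- The mutual information `I(X : Y) = D(P_XY ‖ P_X × P_Y)` of the joint distribution `P · W`;
its output marginal is `P.bind W`. -/
def mutualInfo [Fintype X] [Fintype Y] (P : PMF X) (W : Channel X Y) : EReal :=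
  renyiDiv 1 (joint P W) (prodDist P (P.bind W))

/-- The Shannon capacity `I(W)`. -/
def shannonCapacity [Fintype X] [Fintype Y] (W : Channel X Y) : EReal :=
  ⨆ P : PMF X, mutualInfo P W

/-- `n` independent uses `W^{×n}` of the channel `W`. -/
def Channel.power [Fintype Y] (W : Channel X Y) (n : ℕ) : Channel (Fin n → X) (Fin n → Y) :=
  fun x => PMF.ofFintype (fun y => ∏ i, W (x i) (y i)) (by
    rw [← Fintype.prod_sum]
    exact Finset.prod_eq_one fun i _ => by
      simpa only [tsum_fintype] using (W (x i)).tsum_coe)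

/-- The channels `X → Y` that can be realized with at most `c` bits of communication and shared
randomness `K` of arbitrary finite size: the sender encodes `(x, k)` into a message `j` out of `N`,
`log₂ N ≤ c`, and the receiver decodes `(j, k)` into `y`, both by local stochastic maps. -/
def simulations (X Y : Type*) (c : ℝ) : Set (Channel X Y) :=
  {M | ∃ N : ℕ, 1 ≤ N ∧ Real.logb 2 N ≤ c ∧
    ∃ (K : Type) (_ : Fintype K) (PK : PMF K)
      (E : Channel (X × K) (Fin N)) (D : Channel (Fin N × K) Y),
      ∀ x y, M x y = ∑ k, ∑ j, PK k * E (x, k) j * D (j, k) y}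

/-- The divergence `D_α(W, M)` between two channels, in the worst case over input distributions. -/
def channelDiv [Fintype X] [Fintype Y] (α : ℝ≥0∞) (W M : Channel X Y) : EReal :=
  ⨆ P : PMF X, renyiDiv α (joint P W) (joint P M)

/-- The optimal performance of simulating `W` with at most `c` bits of communication. -/
def simPerformance [Fintype X] [Fintype Y] (α : ℝ≥0∞) (W : Channel X Y) (c : ℝ) : EReal :=
  ⨅ M ∈ simulations X Y c, channelDiv α W M

/-- The `α`-Rényi simulation rate: the infimum of `limsup c_n / n` over all sequences of
nonnegative communication costs for which the optimal performance vanishes asymptotically. -/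
def renyiSimulationRate [Fintype X] [Fintype Y] (α : ℝ≥0∞) (W : Channel X Y) : EReal :=
  sInf {R | ∃ c : ℕ → ℝ, (∀ n, 0 ≤ c n) ∧
    Filter.limsup (fun n => simPerformance α (W.power n) (c n)) Filter.atTop = 0 ∧
    R = Filter.limsup (fun n => ((c n / n : ℝ) : EReal)) Filter.atTop}

end ReverseShannon

end

open scoped ENNReal

noncomputable section

namespace ReverseShannon

open Filter Topology

-- Fidelity: monotonicity, homogeneity and comparison of orders.

section Fidelity

variable {A : Type*} [Fintype A]

-- The fidelity is monotone and homogeneous of degree one in its second argument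
-- (`fidelity_mono_right`, `fidelity_const_mul_right`). Pointwise domination of one channel by a
-- multiple of another therefore becomes a divergence bound, at every order at once.
--
-- Converse. Bounding the encoder's probabilities by 1 shows that a channel simulated with `c` bits
-- is at most `2 ^ c` times a constant channel (`exists_le_of_mem_simulations`). So its fidelity to
-- `W^n` is at most `2 ^ c` times the best fidelity of a product distribution, which for i.i.d.
-- inputs is at most the `n`-th power of the single-letter optimum (`fidelity_prodDist_power_le`).
-- Fidelity at least 1/2 then forces `c ≥ n I_α(W) - O(1)`. For orders in `(0, 1]` this improves:
-- Hölder's inequality turns a lower bound on the fidelity of order `a < 1` into one, independent of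
-- `n`, at any order `b` in `(a, 1)` (`fidelity_rpow_le_of_lt`), and Sibson's information of order
-- `b` exceeds any number below the mutual information once `b` is close to 1
-- (`exists_sibsonSum_rpow_le`). At order 0 the Hölder exponent `a / b` would vanish, and this
-- argument gives nothing.
--
-- Achievability. If `L ≤ A Q` pointwise, rejection sampling from shared samples of `Q` yields, with
-- `m + 1` messages, a channel that is at least `(1 - (1 - 1/A)^m) L` (`exists_isSimulatedBy_ge`),
-- so slightly more than `log A` bits suffice. A minimax argument (`exists_fullSupport_forall_lt`)
-- supplies one `Q` good for all inputs. For finite orders above 1, `L` is `W^n` truncated at a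
-- multiple of `Q^n`. Orders in `(0, 1]` reduce to an order slightly above 1, since fidelities of
-- smaller order are larger. At order `∞`, `L` is `W^n` itself; at order 0 it is `Q^n` conditioned
-- on the support of `W^n`.

theorem fidelity_zero (P Q : A → ℝ≥0∞) :
    fidelity 0 P Q = ∑ x, (Function.support P).indicator Q x := by
  simp [fidelity]

theorem fidelity_one (P Q : A → ℝ≥0∞) :
    fidelity 1 P Q = ∏ x, (Q x / P x) ^ (P x).toReal := by
  simp [fidelity]

theorem fidelity_top (P Q : A → ℝ≥0∞) :
    fidelity ∞ P Q = ⨅ x ∈ Function.support P, Q x / P x := by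
  simp [fidelity]

theorem fidelity_ofReal {a : ℝ} (ha : 0 < a) (ha' : a ≠ 1) (P Q : A → ℝ≥0∞) :
    fidelity (ENNReal.ofReal a) P Q = (∑ x, P x ^ a * Q x ^ (1 - a)) ^ (1 / (1 - a)) := by
  have h0 : ENNReal.ofReal a ≠ 0 := by simpa using ha
  have h1 : ENNReal.ofReal a ≠ 1 := by simpa using ha'
  rw [fidelity, if_neg h0, if_neg h1, if_neg ENNReal.ofReal_ne_top, ENNReal.toReal_ofReal ha.le]

/-- An order is `0`, `1`, `∞`, or a positive real number other than `1`. -/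
theorem order_cases (α : ℝ≥0∞) :
    α = 0 ∨ α = 1 ∨ α = ∞ ∨ ∃ a : ℝ, 0 < a ∧ a ≠ 1 ∧ α = ENNReal.ofReal a := by
  by_cases h0 : α = 0
  · exact .inl h0
  by_cases h1 : α = 1
  · exact .inr (.inl h1)
  by_cases ht : α = ∞
  · exact .inr (.inr (.inl ht))
  refine .inr (.inr (.inr ⟨α.toReal, ENNReal.toReal_pos h0 ht, ?_, (ENNReal.ofReal_toReal ht).symm⟩))
  intro h
  exact h1 (by rw [← ENNReal.ofReal_toReal ht, h, ENNReal.ofReal_one])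

theorem ennreal_rpow_le_rpow_of_nonpos {x y : ℝ≥0∞} {z : ℝ} (h : x ≤ y) (hz : z ≤ 0) :
    y ^ z ≤ x ^ z := by
  have := ENNReal.inv_le_inv.2 (ENNReal.rpow_le_rpow h (neg_nonneg.2 hz))
  rwa [← ENNReal.rpow_neg, ← ENNReal.rpow_neg, neg_neg] at this

theorem fidelity_mono_right (α : ℝ≥0∞) (P : A → ℝ≥0∞) {Q Q' : A → ℝ≥0∞} (h : ∀ x, Q x ≤ Q' x) :
    fidelity α P Q ≤ fidelity α P Q' := by
  rcases order_cases α with rfl | rfl | rfl | ⟨a, ha, ha', rfl⟩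
  · simp only [fidelity_zero]
    exact Finset.sum_le_sum fun x _ => Set.indicator_le_indicator (h x)
  · simp only [fidelity_one]
    exact Finset.prod_le_prod' fun x _ =>
      ENNReal.rpow_le_rpow (ENNReal.div_le_div_right (h x) _) ENNReal.toReal_nonneg
  · simp only [fidelity_top]
    exact iInf₂_mono fun x _ => ENNReal.div_le_div_right (h x) _
  · simp only [fidelity_ofReal ha ha']
    rcases lt_or_gt_of_ne ha' with h1 | h1
    · have : 0 < 1 - a := by linarith
      gcongr with x
      exact h x
    · have : 1 - a < 0 := by linarith
      refine ennreal_rpow_le_rpow_of_nonpos (Finset.sum_le_sum fun x _ => ?_)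
        (one_div_neg.2 this).le
      exact mul_le_mul_right (ennreal_rpow_le_rpow_of_nonpos (h x) this.le) _

theorem ennreal_rpow_sum {ι : Type*} (s : Finset ι) {c : ℝ≥0∞} (hc : c ≠ 0) (hc' : c ≠ ∞) (f : ι → ℝ) :
    c ^ (∑ i ∈ s, f i) = ∏ i ∈ s, c ^ f i := by
  classical
  induction s using Finset.induction_on with
  | empty => simp
  | insert i s hi ih => rw [Finset.sum_insert hi, Finset.prod_insert hi, ENNReal.rpow_add _ _ hc hc', ih]

theorem ne_top_of_sum_eq_one {P : A → ℝ≥0∞} (hP : ∑ x, P x = 1) (x : A) : P x ≠ ∞ := by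
  have : P x ≤ 1 := hP ▸ Finset.single_le_sum (fun _ _ => zero_le) (Finset.mem_univ x)
  exact (this.trans_lt ENNReal.one_lt_top).ne

theorem sum_toReal_eq_one {P : A → ℝ≥0∞} (hP : ∑ x, P x = 1) : ∑ x, (P x).toReal = 1 := by
  rw [← ENNReal.toReal_sum fun x _ => ne_top_of_sum_eq_one hP x, hP, ENNReal.toReal_one]

/-- Normalization of `P` matters only at order 1, where the factors `c ^ P x` multiply to `c`. -/
theorem fidelity_const_mul_right (α : ℝ≥0∞) {P : A → ℝ≥0∞} (hP : ∑ x, P x = 1) (Q : A → ℝ≥0∞)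
    {c : ℝ≥0∞} (hc : c ≠ 0) (hc' : c ≠ ∞) :
    fidelity α P (fun x => c * Q x) = c * fidelity α P Q := by
  rcases order_cases α with rfl | rfl | rfl | ⟨a, ha, ha', rfl⟩
  · simp only [fidelity_zero, Finset.mul_sum]
    refine Finset.sum_congr rfl fun x _ => ?_
    by_cases hx : x ∈ Function.support P <;> simp [hx]
  · simp only [fidelity_one, mul_div_assoc]
    simp_rw [ENNReal.mul_rpow_of_nonneg _ _ ENNReal.toReal_nonneg]
    rw [Finset.prod_mul_distrib, ← ennreal_rpow_sum _ hc hc', sum_toReal_eq_one hP,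
      ENNReal.rpow_one]
  · simp only [fidelity_top, mul_div_assoc]
    rw [ENNReal.mul_iInf_of_ne hc hc']
    refine iInf_congr fun x => ?_
    by_cases hx : x ∈ Function.support P
    · simp [hx]
    · simp [hx, ENNReal.mul_top hc]
  · simp only [fidelity_ofReal ha ha']
    have h1 : 1 - a ≠ 0 := sub_ne_zero.2 (Ne.symm ha')
    have key : ∀ x, P x ^ a * (c * Q x) ^ (1 - a) = c ^ (1 - a) * (P x ^ a * Q x ^ (1 - a)) := by
      intro x
      rw [ENNReal.mul_rpow_eq_ite, if_neg (by simp [hc, hc']), mul_left_comm]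
    have hd : c ^ (1 - a) ≠ 0 := (ENNReal.rpow_pos (pos_iff_ne_zero.2 hc) hc').ne'
    have hd' : c ^ (1 - a) ≠ ∞ := ENNReal.rpow_ne_top_of_ne_zero hc hc'
    simp_rw [key]
    rw [← Finset.mul_sum, ENNReal.mul_rpow_eq_ite, if_neg (by simp [hd, hd']), ← ENNReal.rpow_mul,
      mul_one_div_cancel h1, ENNReal.rpow_one]

/-- Weighted arithmetic-geometric mean inequality in `ℝ≥0∞`. -/
theorem prod_rpow_le_sum_mul {w z : A → ℝ≥0∞} (hw : ∑ x, w x = 1) :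
    ∏ x, z x ^ (w x).toReal ≤ ∑ x, w x * z x := by
  by_cases h : ∃ x, w x ≠ 0 ∧ z x = ∞
  · obtain ⟨x, hx, hx'⟩ := h
    have : ∑ x, w x * z x = ∞ := by
      rw [ENNReal.sum_eq_top]
      exact ⟨x, Finset.mem_univ _, by rw [hx', ENNReal.mul_top hx]⟩
    rw [this]
    exact le_top
  push Not at h
  have hwt := fun x => ne_top_of_sum_eq_one hw x
  have hs : ∑ x, (w x).toNNReal = 1 := by
    rw [← ENNReal.toNNReal_sum fun x _ => hwt x, hw, ENNReal.toNNReal_one]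
  have key := NNReal.geom_mean_le_arith_mean_weighted Finset.univ (fun x => (w x).toNNReal)
    (fun x => (z x).toNNReal) hs
  rw [← ENNReal.coe_le_coe, ENNReal.ofNNReal_finsetProd, ENNReal.ofNNReal_finsetSum] at key
  refine le_trans (le_of_eq (Finset.prod_congr rfl fun x _ => ?_))
    (key.trans (Finset.sum_le_sum fun x _ => ?_))
  · by_cases hx : w x = 0
    · simp [hx]
    · rw [ENNReal.coe_rpow_of_nonneg _ (NNReal.coe_nonneg _), ENNReal.coe_toNNReal (h x hx)]
      rfl
  · rw [ENNReal.coe_mul, ENNReal.coe_toNNReal (hwt x)]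
    exact mul_le_mul_right ENNReal.coe_toNNReal_le_self _

/-- Weighted AM-GM with weights `P` and values `(Q / P) ^ (1 - a)`. Extracting the root of order `1
- a` compares order 1 with order `a`, the direction depending on the sign of `1 - a`. -/
theorem fidelity_one_rpow_le {P Q : A → ℝ≥0∞} (hP : ∑ x, P x = 1) (hQ : ∀ x, Q x ≠ ∞) {a : ℝ}
    (ha : 0 < a) :
    fidelity 1 P Q ^ (1 - a) ≤ ∑ x, P x ^ a * Q x ^ (1 - a) := by
  have hPt := fun x => ne_top_of_sum_eq_one hP x
  rw [fidelity_one, ← ENNReal.prod_rpow_of_ne_top]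
  · calc ∏ x, ((Q x / P x) ^ (P x).toReal) ^ (1 - a)
        = ∏ x, ((Q x / P x) ^ (1 - a)) ^ (P x).toReal := by
          simp_rw [← ENNReal.rpow_mul, mul_comm]
      _ ≤ ∑ x, P x * (Q x / P x) ^ (1 - a) := prod_rpow_le_sum_mul hP
      _ = ∑ x, P x ^ a * Q x ^ (1 - a) := by
          refine Finset.sum_congr rfl fun x _ => ?_
          by_cases hx : P x = 0
          · simp [hx, ENNReal.zero_rpow_of_pos ha]
          · rw [div_eq_mul_inv, ENNReal.mul_rpow_of_ne_top (hQ x) (by simpa using hx),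
              ENNReal.inv_rpow, ← ENNReal.rpow_neg, mul_left_comm, mul_comm (Q x ^ _)]
            congr 1
            nth_rw 1 [← ENNReal.rpow_one (P x)]
            rw [← ENNReal.rpow_add _ _ hx (hPt x)]
            congr 1
            ring
  · intro x _
    by_cases hx : P x = 0
    · simp [hx]
    · exact ENNReal.rpow_ne_top_of_nonneg ENNReal.toReal_nonneg (ENNReal.div_ne_top (hQ x) hx)

theorem fidelity_one_le_of_lt_one {P Q : A → ℝ≥0∞} (hP : ∑ x, P x = 1) (hQ : ∀ x, Q x ≠ ∞) {a : ℝ}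
    (ha : 0 < a) (ha' : a < 1) : fidelity 1 P Q ≤ fidelity (ENNReal.ofReal a) P Q := by
  rw [fidelity_ofReal ha ha'.ne, one_div, ENNReal.le_rpow_inv_iff (by linarith)]
  exact fidelity_one_rpow_le hP hQ ha

theorem fidelity_le_fidelity_one {P Q : A → ℝ≥0∞} (hP : ∑ x, P x = 1) (hQ : ∀ x, Q x ≠ ∞) {a : ℝ}
    (ha' : 1 < a) : fidelity (ENNReal.ofReal a) P Q ≤ fidelity 1 P Q := by
  rw [fidelity_ofReal (by linarith) ha'.ne']
  have h1 : 1 - a ≠ 0 := by linarith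
  calc _ ≤ (fidelity 1 P Q ^ (1 - a)) ^ (1 / (1 - a)) :=
        ennreal_rpow_le_rpow_of_nonpos (fidelity_one_rpow_le hP hQ (by linarith))
          (one_div_neg.2 (by linarith)).le
    _ = fidelity 1 P Q := by
        rw [← ENNReal.rpow_mul, mul_one_div_cancel h1, ENNReal.rpow_one]

/-- Hölder's inequality in multiplicative form. -/
theorem sum_rpow_mul_rpow_le (f g : A → ℝ≥0∞) {l : ℝ} (hl : 0 < l) (hl' : l < 1) :
    ∑ x, f x ^ l * g x ^ (1 - l) ≤ (∑ x, f x) ^ l * (∑ x, g x) ^ (1 - l) := by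
  have hl1 : 0 < 1 - l := by linarith
  have hc : (l⁻¹).HolderConjugate (1 - l)⁻¹ := by
    rw [Real.holderConjugate_iff]
    exact ⟨(one_lt_inv₀ hl).2 hl', by simp⟩
  have := ENNReal.inner_le_Lp_mul_Lq Finset.univ (fun x => f x ^ l) (fun x => g x ^ (1 - l)) hc
  simpa [← ENNReal.rpow_mul, hl.ne', hl1.ne', mul_inv_cancel₀] using this

theorem fidelity_le_one (α : ℝ≥0∞) {P Q : A → ℝ≥0∞} (hP : ∑ x, P x = 1) (hQ : ∑ x, Q x = 1) :
    fidelity α P Q ≤ 1 := by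
  have hQt := fun x => ne_top_of_sum_eq_one hQ x
  have hPt := fun x => ne_top_of_sum_eq_one hP x
  have h1 : fidelity 1 P Q ≤ 1 := by
    rw [fidelity_one]
    refine (prod_rpow_le_sum_mul hP).trans (le_trans (Finset.sum_le_sum fun x _ => ?_) hQ.le)
    exact ENNReal.mul_div_le
  rcases order_cases α with rfl | rfl | rfl | ⟨a, ha, ha', rfl⟩
  · rw [fidelity_zero, ← hQ]
    exact Finset.sum_le_sum fun x _ => Set.indicator_le_self _ _ x
  · exact h1
  · have key : ∀ x, fidelity ∞ P Q * P x ≤ Q x := by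
      intro x
      by_cases hx : P x = 0
      · simp [hx]
      · rw [← ENNReal.le_div_iff_mul_le (.inl hx) (.inl (hPt x)), fidelity_top]
        exact iInf₂_le x hx
    calc fidelity ∞ P Q = ∑ x, fidelity ∞ P Q * P x := by rw [← Finset.mul_sum, hP, mul_one]
      _ ≤ ∑ x, Q x := Finset.sum_le_sum fun x _ => key x
      _ = 1 := hQ
  · rcases lt_or_gt_of_ne ha' with h | h
    · rw [fidelity_ofReal ha ha']
      refine ENNReal.rpow_le_one ?_ (one_div_pos.2 (by linarith)).le
      simpa [hP, hQ] using sum_rpow_mul_rpow_le P Q ha h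
    · exact (fidelity_le_fidelity_one hP hQt h).trans h1

/-- For orders in `(0, 1)` a fidelity of larger order is bounded below by that of smaller order. -/
theorem fidelity_rpow_le_of_lt {P Q : A → ℝ≥0∞} (hQ : ∑ x, Q x = 1) {a b : ℝ} (ha : 0 < a)
    (hab : a < b) (hb : b < 1) :
    fidelity (ENNReal.ofReal a) P Q ^ (1 - a) ≤
      fidelity (ENNReal.ofReal b) P Q ^ ((1 - b) * (a / b)) := by
  have hb0 := ha.trans hab
  have ha1 : 1 - a ≠ 0 := by linarith
  have hb1 : 1 - b ≠ 0 := by linarith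
  rw [fidelity_ofReal ha (by linarith), fidelity_ofReal hb0 (by linarith), ← ENNReal.rpow_mul,
    one_div_mul_cancel ha1, ENNReal.rpow_one, ← ENNReal.rpow_mul, ← mul_assoc,
    one_div_mul_cancel hb1, one_mul]
  -- Hölder for the factorization `P^a Q^(1-a) = (P^b Q^(1-b))^(a/b) Q^(1-a/b)`.
  have := sum_rpow_mul_rpow_le (fun x => P x ^ b * Q x ^ (1 - b)) Q (div_pos ha hb0)
    ((div_lt_one hb0).2 hab)
  rw [hQ, ENNReal.one_rpow, mul_one] at this
  refine le_trans (le_of_eq (Finset.sum_congr rfl fun x _ => ?_)) this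
  have hl : 0 ≤ a / b := (div_pos ha hb0).le
  rw [ENNReal.mul_rpow_of_nonneg _ _ hl, ← ENNReal.rpow_mul, ← ENNReal.rpow_mul, mul_assoc,
    ← ENNReal.rpow_add_of_nonneg _ _ (mul_nonneg (by linarith) hl)
      (by rw [sub_nonneg, div_le_one hb0]; exact hab.le)]
  congr 2 <;> field_simp
  ring

end Fidelity

-- Converse bound, Sibson's formula, and multiplicativity for i.i.d. inputs.

section Converse

section Logarithm

theorem log₂_two_rpow (t : ℝ) : log₂ (ENNReal.ofReal (2 ^ t)) = t := by
  have h2 : Real.log 2 ≠ 0 := (Real.log_pos one_lt_two).ne'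
  rw [log₂, ENNReal.log_ofReal_of_pos (by positivity), Real.log_rpow two_pos, ← EReal.coe_div,
    mul_div_cancel_right₀ _ h2]

theorem log₂_strictMono : StrictMono log₂ := fun _ _ h =>
  EReal.div_lt_div_right_of_pos (by exact_mod_cast Real.log_pos one_lt_two) (EReal.coe_ne_top _)
    (ENNReal.log_lt_log h)

variable {A : Type*} [Fintype A] {α : ℝ≥0∞} {P Q : A → ℝ≥0∞} {t : ℝ}

theorem renyiDiv_le_iff : renyiDiv α P Q ≤ t ↔ ENNReal.ofReal (2 ^ (-t)) ≤ fidelity α P Q := by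
  rw [renyiDiv, EReal.neg_le, ← log₂_strictMono.le_iff_le, log₂_two_rpow, EReal.coe_neg]

theorem le_renyiDiv_iff : t ≤ renyiDiv α P Q ↔ fidelity α P Q ≤ ENNReal.ofReal (2 ^ (-t)) := by
  rw [renyiDiv, EReal.le_neg, ← log₂_strictMono.le_iff_le, log₂_two_rpow, EReal.coe_neg]

theorem renyiDiv_lt_iff : renyiDiv α P Q < t ↔ ENNReal.ofReal (2 ^ (-t)) < fidelity α P Q := by
  rw [← not_le, le_renyiDiv_iff, not_le]

theorem lt_renyiDiv_iff : t < renyiDiv α P Q ↔ fidelity α P Q < ENNReal.ofReal (2 ^ (-t)) := by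
  rw [← not_le, renyiDiv_le_iff, not_le]

end Logarithm

variable {X Y : Type*}

theorem PMF_sum_coe [Fintype X] (P : PMF X) : ∑ x, P x = 1 := by
  rw [← tsum_fintype (L := .unconditional _), P.tsum_coe]

theorem sum_joint [Fintype X] [Fintype Y] (P : PMF X) (W : Channel X Y) :
    ∑ p, joint P W p = 1 := by
  simp only [joint, Fintype.sum_prod_type, ← Finset.mul_sum, PMF_sum_coe, mul_one]

theorem prodDist_eq_joint (P : PMF X) (Q : PMF Y) : prodDist P Q = joint P (fun _ => Q) := rfl

theorem joint_ne_top (P : PMF X) (W : Channel X Y) (p : X × Y) : joint P W p ≠ ∞ :=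
  ENNReal.mul_ne_top (P.apply_ne_top _) ((W p.1).apply_ne_top _)

/-- Since `P^a P^(1-a) = P`, the input distribution enters only as an average; this linearity in `P`
is what makes the minimax argument applicable. -/
theorem sum_joint_rpow [Fintype X] [Fintype Y] (P : PMF X) (W M : Channel X Y) {a : ℝ}
    (ha : 0 < a) :
    ∑ p, joint P W p ^ a * joint P M p ^ (1 - a) =
      ∑ x, P x * ∑ y, W x y ^ a * M x y ^ (1 - a) := by
  simp only [joint, Fintype.sum_prod_type, Finset.mul_sum]
  refine Finset.sum_congr rfl fun x _ => Finset.sum_congr rfl fun y _ => ?_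
  by_cases hx : P x = 0
  · simp [hx, ENNReal.zero_rpow_of_pos ha]
  · have hxt := P.apply_ne_top x
    rw [ENNReal.mul_rpow_of_ne_top hxt ((W x).apply_ne_top y),
      ENNReal.mul_rpow_of_ne_top hxt ((M x).apply_ne_top y), mul_mul_mul_comm,
      ← ENNReal.rpow_add _ _ hx hxt]
    simp

section Products

theorem Channel.power_apply [Fintype Y] (W : Channel X Y) (n : ℕ) (x : Fin n → X)
    (y : Fin n → Y) : W.power n x y = ∏ i, W (x i) (y i) := rfl

/-- The `n`-fold product of a probability distribution. -/
def iid [Fintype X] (P : PMF X) (n : ℕ) : PMF (Fin n → X) :=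
  Channel.power (fun _ : Unit => P) n fun _ => ()

theorem iid_apply [Fintype X] (P : PMF X) (n : ℕ) (x : Fin n → X) : iid P n x = ∏ i, P (x i) := rfl

theorem sum_prod_eq_pow {R : Type*} [CommSemiring R] [Fintype X] (n : ℕ) (f : X → R) :
    ∑ x : Fin n → X, ∏ i, f (x i) = (∑ x, f x) ^ n := by
  rw [← Fintype.prod_sum, Finset.prod_const, Finset.card_univ, Fintype.card_fin]

end Products

/-- A channel simulated with `c` bits of communication is dominated by `2 ^ c` times a constant
channel. -/
theorem exists_le_of_mem_simulations [Fintype Y] {c : ℝ} {M : Channel X Y}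
    (hM : M ∈ simulations X Y c) :
    ∃ Q : PMF Y, ∀ x y, M x y ≤ ENNReal.ofReal (2 ^ c) * Q y := by
  obtain ⟨N, hN, hc, K, _, PK, E, D, h⟩ := hM
  have hN0 : (N : ℝ≥0∞) ≠ 0 := by exact_mod_cast (Nat.one_le_iff_ne_zero.1 hN)
  have hNt : (N : ℝ≥0∞) ≠ ∞ := ENNReal.natCast_ne_top N
  have hNc : (N : ℝ≥0∞) ≤ ENNReal.ofReal (2 ^ c) := by
    rw [← ENNReal.ofReal_natCast]
    refine ENNReal.ofReal_le_ofReal ?_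
    exact (Real.logb_le_iff_le_rpow one_lt_two (by exact_mod_cast hN)).1 hc
  -- The output distribution of the decoder when the message is uniform and independent of the
  -- input.
  refine ⟨PMF.ofFintype (fun y => ∑ k, ∑ j, PK k * (N : ℝ≥0∞)⁻¹ * D (j, k) y) ?_, fun x y => ?_⟩
  · rw [Finset.sum_comm]
    have : ∀ k, ∑ y, ∑ j, PK k * (N : ℝ≥0∞)⁻¹ * D (j, k) y = PK k := by
      intro k
      rw [Finset.sum_comm]
      simp only [← Finset.mul_sum, PMF_sum_coe, Finset.sum_const, Finset.card_univ,
        Fintype.card_fin, nsmul_eq_mul, mul_one]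
      rw [ENNReal.mul_inv_cancel hN0 hNt, mul_one]
    simp_rw [this, PMF_sum_coe]
  · rw [h, PMF.ofFintype_apply]
    refine le_trans ?_ (mul_le_mul_left hNc _)
    simp only [Finset.mul_sum]
    refine Finset.sum_le_sum fun k _ => Finset.sum_le_sum fun j _ => ?_
    calc PK k * E (x, k) j * D (j, k) y ≤ PK k * 1 * D (j, k) y := by
          gcongr
          exact PMF.coe_le_one _ _
      _ = N * (PK k * (N : ℝ≥0∞)⁻¹ * D (j, k) y) := by
          rw [mul_comm (PK k) (_⁻¹), ← mul_assoc, ← mul_assoc, ENNReal.mul_inv_cancel hN0 hNt,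
            one_mul, mul_one]

/-- Converse bound on the fidelity of a simulation. -/
theorem fidelity_joint_le_of_mem_simulations [Fintype X] [Fintype Y] {α : ℝ≥0∞} {c : ℝ}
    {W M : Channel X Y} (hM : M ∈ simulations X Y c) {P : PMF X} {s : ℝ≥0∞}
    (hs : ∀ Q : PMF Y, fidelity α (joint P W) (prodDist P Q) ≤ s) :
    fidelity α (joint P W) (joint P M) ≤ ENNReal.ofReal (2 ^ c) * s := by
  obtain ⟨Q, hQ⟩ := exists_le_of_mem_simulations hM
  have h2 : (0 : ℝ) < 2 ^ c := by positivity
  calc fidelity α (joint P W) (joint P M)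
      ≤ fidelity α (joint P W) (fun p => ENNReal.ofReal (2 ^ c) * prodDist P Q p) := by
        refine fidelity_mono_right _ _ fun p => ?_
        rw [joint, prodDist, mul_left_comm]
        exact mul_le_mul_right (hQ _ _) _
    _ = ENNReal.ofReal (2 ^ c) * fidelity α (joint P W) (prodDist P Q) :=
        fidelity_const_mul_right _ (sum_joint P W) _ (by simpa using h2) ENNReal.ofReal_ne_top
    _ ≤ _ := mul_le_mul_right (hs Q) _

theorem sum_mul_rpow_ne_top [Fintype X] {a : ℝ} (ha : 0 < a) (P : PMF X) (W : Channel X Y) (y : Y) :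
    ∑ x, P x * W x y ^ a ≠ ∞ :=
  ENNReal.sum_ne_top.2 fun x _ => ENNReal.mul_ne_top (P.apply_ne_top x)
    (ENNReal.rpow_ne_top_of_nonneg ha.le ((W x).apply_ne_top y))

section Sibson

variable [Fintype X] [Fintype Y]

/-- The sum in Sibson's closed formula for the Rényi mutual information. -/
def sibsonSum (a : ℝ) (P : PMF X) (W : Channel X Y) : ℝ≥0∞ :=
  ∑ y, (∑ x, P x * W x y ^ a) ^ (1 / a)

theorem fidelity_prodDist_eq {a : ℝ} (ha : 0 < a) (ha' : a ≠ 1) (P : PMF X) (W : Channel X Y)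
    (Q : PMF Y) :
    fidelity (ENNReal.ofReal a) (joint P W) (prodDist P Q) =
      (∑ y, (∑ x, P x * W x y ^ a) * Q y ^ (1 - a)) ^ (1 / (1 - a)) := by
  rw [fidelity_ofReal ha ha', prodDist_eq_joint, sum_joint_rpow P W _ ha]
  congr 1
  simp only [Finset.mul_sum, Finset.sum_mul]
  rw [Finset.sum_comm]
  simp only [mul_assoc]

/-- Hölder's inequality, direct for `a < 1` and reversed for `a > 1`; equality holds for `Q`
proportional to `g ^ (1 / a)`, which is the witness in `exists_fidelity_prodDist_eq_sibsonSum`. -/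
theorem fidelity_prodDist_le_sibsonSum {a : ℝ} (ha : 0 < a) (ha' : a ≠ 1) (P : PMF X)
    (W : Channel X Y) (Q : PMF Y) :
    fidelity (ENNReal.ofReal a) (joint P W) (prodDist P Q) ≤ sibsonSum a P W ^ (a / (1 - a)) := by
  rw [fidelity_prodDist_eq ha ha', sibsonSum]
  set g : Y → ℝ≥0∞ := fun y => ∑ x, P x * W x y ^ a
  rw [div_eq_mul_one_div a, ENNReal.rpow_mul]
  rcases lt_or_gt_of_ne ha' with h | h
  · refine ENNReal.rpow_le_rpow ?_ (one_div_pos.2 (by linarith)).le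
    have := sum_rpow_mul_rpow_le (fun y => g y ^ (1 / a)) Q ha h
    simpa [← ENNReal.rpow_mul, ha.ne', PMF_sum_coe] using this
  · refine ennreal_rpow_le_rpow_of_nonpos ?_ (one_div_neg.2 (by linarith)).le
    by_cases hex : ∃ y, Q y = 0 ∧ g y ≠ 0
    · obtain ⟨y, hQ, hg⟩ := hex
      refine le_of_le_of_eq le_top (ENNReal.sum_eq_top.2 ⟨y, Finset.mem_univ _, ?_⟩).symm
      rw [hQ, ENNReal.zero_rpow_of_neg (by linarith), ENNReal.mul_top hg]
    push Not at hex
    have h1 : 1 / a < 1 := by rw [div_lt_one ha]; exact h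
    -- The reverse inequality is Hölder with exponent `1 / a` for `g^(1/a) = (g Q^(1-a))^(1/a)
    -- Q^(1-1/a)`, valid where `Q` vanishes because `g` vanishes there too.
    have := sum_rpow_mul_rpow_le (fun y => g y * Q y ^ (1 - a)) Q (one_div_pos.2 ha) h1
    rw [PMF_sum_coe, ENNReal.one_rpow, mul_one, one_div, ENNReal.le_rpow_inv_iff ha] at this
    refine le_trans (ENNReal.rpow_le_rpow (Finset.sum_le_sum fun y _ => ?_) ha.le) this
    by_cases hQ : Q y = 0
    · have hg : g y = 0 := hex y hQ
      change g y ^ (1 / a) ≤ _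
      rw [hg, ENNReal.zero_rpow_of_pos (by positivity)]
      exact zero_le
    · rw [ENNReal.mul_rpow_of_nonneg _ _ (by positivity), mul_assoc, ← ENNReal.rpow_mul, one_div,
        ← ENNReal.rpow_add _ _ hQ (Q.apply_ne_top y)]
      have : (1 - a) * a⁻¹ + (1 - a⁻¹) = 0 := by field_simp; ring
      rw [this, ENNReal.rpow_zero, mul_one]

theorem sibsonSum_ne_top {a : ℝ} (ha : 0 < a) (P : PMF X) (W : Channel X Y) :
    sibsonSum a P W ≠ ∞ :=
  ENNReal.sum_ne_top.2 fun y _ => ENNReal.rpow_ne_top_of_nonneg (by positivity)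
    (sum_mul_rpow_ne_top ha P W y)

theorem sibsonSum_ne_zero {a : ℝ} (ha : 0 < a) (P : PMF X) (W : Channel X Y) :
    sibsonSum a P W ≠ 0 := by
  intro h
  have h0 : ∀ x y, P x * W x y ^ a = 0 := by
    intro x y
    have h1 := (Finset.sum_eq_zero_iff.1 h) y (Finset.mem_univ y)
    rw [ENNReal.rpow_eq_zero_iff_of_pos (by positivity)] at h1
    exact (Finset.sum_eq_zero_iff.1 h1) x (Finset.mem_univ x)
  obtain ⟨x, hx⟩ := P.support_nonempty
  obtain ⟨y, hy⟩ := (W x).support_nonempty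
  rw [PMF.mem_support_iff] at hx hy
  rcases mul_eq_zero.1 (h0 x y) with h1 | h1
  · exact hx h1
  · exact hy ((ENNReal.rpow_eq_zero_iff_of_pos ha).1 h1)

theorem exists_fidelity_prodDist_eq_sibsonSum {a : ℝ} (ha : 0 < a) (ha' : a ≠ 1) (P : PMF X)
    (W : Channel X Y) :
    ∃ Q : PMF Y, fidelity (ENNReal.ofReal a) (joint P W) (prodDist P Q) =
      sibsonSum a P W ^ (a / (1 - a)) := by
  have h0 := sibsonSum_ne_zero ha P W
  have ht := sibsonSum_ne_top ha P W
  refine ⟨PMF.ofFintype (fun y => (∑ x, P x * W x y ^ a) ^ (1 / a) / sibsonSum a P W) ?_, ?_⟩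
  · simp_rw [div_eq_mul_inv _ (sibsonSum a P W)]
    rw [← Finset.sum_mul]
    exact ENNReal.mul_inv_cancel h0 ht
  rw [fidelity_prodDist_eq ha ha', div_eq_mul_one_div a, ENNReal.rpow_mul]
  congr 1
  set g : Y → ℝ≥0∞ := fun y => ∑ x, P x * W x y ^ a with hg
  set S := sibsonSum a P W with hS
  have key : ∀ y, g y * (g y ^ (1 / a) / S) ^ (1 - a) = g y ^ (1 / a) * S ^ (a - 1) := by
    intro y
    have hgt : g y ≠ ∞ := sum_mul_rpow_ne_top ha P W y
    by_cases hy : g y = 0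
    · rw [hy, ENNReal.zero_rpow_of_pos (by positivity)]
      simp
    · rw [div_eq_mul_inv _ S, ENNReal.mul_rpow_of_ne_top
        (ENNReal.rpow_ne_top_of_nonneg (by positivity) hgt) (by simpa using h0), ENNReal.inv_rpow,
        ← ENNReal.rpow_neg, neg_sub, ← mul_assoc, ← ENNReal.rpow_mul]
      congr 1
      nth_rw 1 [← ENNReal.rpow_one (g y)]
      rw [← ENNReal.rpow_add _ _ hy hgt]
      congr 1
      field_simp
      ring
  simp only [PMF.ofFintype_apply]
  change ∑ y, g y * (g y ^ (1 / a) / S) ^ (1 - a) = _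
  simp_rw [key]
  rw [← Finset.sum_mul]
  change S * _ = _
  nth_rw 1 [← ENNReal.rpow_one S]
  rw [← ENNReal.rpow_add _ _ h0 ht]
  congr 1
  ring

theorem sibsonSum_power {a : ℝ} (ha : 0 < a) (P : PMF X) (W : Channel X Y) (n : ℕ) :
    sibsonSum a (iid P n) (W.power n) = sibsonSum a P W ^ n := by
  rw [sibsonSum, sibsonSum, ← sum_prod_eq_pow]
  refine Finset.sum_congr rfl fun y _ => ?_
  rw [ENNReal.prod_rpow_of_nonneg (by positivity)]
  congr 1
  rw [Fintype.prod_sum]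
  refine Finset.sum_congr rfl fun x _ => ?_
  rw [iid_apply, Channel.power_apply, ← ENNReal.prod_rpow_of_nonneg ha.le, Finset.prod_mul_distrib]

end Sibson

section Multiplicativity

variable [Fintype X] [Fintype Y]

theorem fidelity_prodDist_power_le_of_sibsonSum_le {a : ℝ} (ha : 0 < a) (ha' : a ≠ 1)
    {P : PMF X} {W : Channel X Y} {s : ℝ≥0∞} (hs : sibsonSum a P W ^ (a / (1 - a)) ≤ s) (n : ℕ)
    (Q : PMF (Fin n → Y)) :
    fidelity (ENNReal.ofReal a) (joint (iid P n) (W.power n)) (prodDist (iid P n) Q) ≤ s ^ n := by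
  refine (fidelity_prodDist_le_sibsonSum ha ha' _ _ _).trans ?_
  rw [sibsonSum_power ha, ← ENNReal.rpow_natCast_mul, mul_comm, ENNReal.rpow_mul_natCast]
  exact pow_le_pow_left' hs n

theorem fidelity_zero_joint (P : PMF X) (W M : Channel X Y) :
    fidelity 0 (joint P W) (joint P M) =
      ∑ x, P x * ∑ y, (Function.support (W x)).indicator (M x) y := by
  simp only [fidelity_zero, Fintype.sum_prod_type, Finset.mul_sum]
  refine Finset.sum_congr rfl fun x _ => Finset.sum_congr rfl fun y _ => ?_
  by_cases hW : W x y = 0 <;> by_cases hP : P x = 0 <;> simp [joint, hW, hP]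

open Classical in
theorem fidelity_zero_prodDist (P : PMF X) (W : Channel X Y) (Q : PMF Y) :
    fidelity 0 (joint P W) (prodDist P Q) = ∑ y, Q y * ∑ x, if W x y = 0 then 0 else P x := by
  rw [prodDist_eq_joint, fidelity_zero_joint]
  simp only [Finset.mul_sum]
  rw [Finset.sum_comm]
  refine Finset.sum_congr rfl fun y _ => Finset.sum_congr rfl fun x _ => ?_
  by_cases hW : W x y = 0 <;> simp [hW, mul_comm]

theorem fidelity_top_prodDist_mul_le (P : PMF X) (W : Channel X Y) (Q : PMF Y) {x : X}
    (hx : P x ≠ 0) (y : Y) : fidelity ∞ (joint P W) (prodDist P Q) * W x y ≤ Q y := by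
  by_cases hW : W x y = 0
  · simp [hW]
  rw [← ENNReal.le_div_iff_mul_le (.inl hW) (.inl ((W x).apply_ne_top y)), fidelity_top]
  refine (iInf₂_le (x, y) (mul_ne_zero hx hW)).trans (le_of_eq ?_)
  exact ENNReal.mul_div_mul_left _ _ hx (P.apply_ne_top x)

/-- The Rényi mutual information of a product is at least the sum of the informations. -/
theorem fidelity_prodDist_power_le {α : ℝ≥0∞} (hα : α ≠ 1) {P : PMF X} {W : Channel X Y}
    {s : ℝ≥0∞} (hs : ∀ Q : PMF Y, fidelity α (joint P W) (prodDist P Q) ≤ s) (n : ℕ)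
    (Q : PMF (Fin n → Y)) :
    fidelity α (joint (iid P n) (W.power n)) (prodDist (iid P n) Q) ≤ s ^ n := by
  classical
  rcases order_cases α with rfl | rfl | rfl | ⟨a, ha, ha', rfl⟩
  · have h1 : ∀ y, (∑ x, if W x y = 0 then 0 else P x) ≤ s := by
      intro y
      -- At order 0 the fidelity is linear in `Q`, so point masses are extremal.
      have := hs (PMF.pure y)
      rw [fidelity_zero_prodDist] at this
      simpa [PMF.pure_apply] using this
    rw [fidelity_zero_prodDist]
    have h2 : ∀ y : Fin n → Y,
        (∑ x, if W.power n x y = 0 then 0 else iid P n x) ≤ s ^ n := by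
      intro y
      calc (∑ x, if W.power n x y = 0 then 0 else iid P n x)
          = ∑ x : Fin n → X, ∏ i, (if W (x i) (y i) = 0 then 0 else P (x i)) := by
            refine Finset.sum_congr rfl fun x _ => ?_
            rw [Channel.power_apply, iid_apply]
            by_cases h : ∏ i, W (x i) (y i) = 0
            · rw [if_pos h]
              obtain ⟨i, hi, h0⟩ := Finset.prod_eq_zero_iff.1 h
              exact (Finset.prod_eq_zero (i := i) hi (by rw [if_pos h0])).symm
            · rw [if_neg h]
              refine Finset.prod_congr rfl fun i hi => ?_
              rw [if_neg (Finset.prod_ne_zero_iff.1 h i hi)]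
        _ = ∏ i, ∑ x, if W x (y i) = 0 then 0 else P x := by
            rw [Fintype.prod_sum]
        _ ≤ ∏ _i : Fin n, s := Finset.prod_le_prod' fun i _ => h1 (y i)
        _ = s ^ n := by simp
    calc ∑ y, Q y * ∑ x, (if W.power n x y = 0 then 0 else iid P n x)
        ≤ ∑ y, Q y * s ^ n := Finset.sum_le_sum fun y _ => mul_le_mul_right (h2 y) _
      _ = s ^ n := by rw [← Finset.sum_mul, PMF_sum_coe, one_mul]
  · exact absurd rfl hα
  · have hmax : ∀ y, ∃ x, P x ≠ 0 ∧ ∀ x', P x' ≠ 0 → W x' y ≤ W x y := by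
      intro y
      obtain ⟨x, hx, hx'⟩ := (Finset.univ.filter fun x => P x ≠ 0).exists_max_image (W · y) (by
        obtain ⟨x, hx⟩ := P.support_nonempty
        exact ⟨x, by simpa using hx⟩)
      exact ⟨x, by simpa using hx, fun x' h' => hx' x' (by simpa using h')⟩
    choose x hx hx' using hmax
    -- At order `∞` the best `Q` is the normalized maximum of the conditional distributions over the
    -- support of `P`, and `m` is its normalization.
    set m : ℝ≥0∞ := ∑ y, W (x y) y with hm
    have hmt : m ≠ ∞ := ENNReal.sum_ne_top.2 fun y _ => (W (x y)).apply_ne_top y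
    have hm0 : m ≠ 0 := by
      intro h
      obtain ⟨x₀, hx₀⟩ := P.support_nonempty
      obtain ⟨y, hy⟩ := (W x₀).support_nonempty
      have h1 : W (x y) y = 0 := Finset.sum_eq_zero_iff.1 h y (Finset.mem_univ y)
      exact hy (le_antisymm (h1 ▸ hx' y x₀ hx₀) zero_le)
    have hsm : m⁻¹ ≤ s := by
      refine le_trans ?_ (hs (PMF.ofFintype (fun y => m⁻¹ * W (x y) y) (by
        rw [← Finset.mul_sum, ENNReal.inv_mul_cancel hm0 hmt])))
      rw [fidelity_top]
      refine le_iInf₂ fun p hp => ?_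
      have hp1 : P p.1 ≠ 0 := left_ne_zero_of_mul hp
      have hp2 : W p.1 p.2 ≠ 0 := right_ne_zero_of_mul hp
      rw [prodDist, joint, ENNReal.mul_div_mul_left _ _ hp1 (P.apply_ne_top _),
        ENNReal.le_div_iff_mul_le (.inl hp2) (.inl ((W p.1).apply_ne_top _)), PMF.ofFintype_apply]
      exact mul_le_mul_right (hx' _ _ hp1) _
    have : fidelity ∞ (joint (iid P n) (W.power n)) (prodDist (iid P n) Q) * m ^ n ≤ 1 := by
      rw [hm, ← sum_prod_eq_pow, Finset.mul_sum, ← PMF_sum_coe Q]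
      refine Finset.sum_le_sum fun y _ => ?_
      refine fidelity_top_prodDist_mul_le (iid P n) (W.power n) Q (x := fun i => x (y i)) ?_ y
      rw [iid_apply]
      exact Finset.prod_ne_zero_iff.2 fun i _ => hx (y i)
    rw [← ENNReal.le_div_iff_mul_le (.inl (pow_ne_zero n hm0)) (.inl (ENNReal.pow_ne_top hmt)),
      one_div, ENNReal.inv_pow] at this
    exact this.trans (pow_le_pow_left' hsm n)
  · obtain ⟨Q', hQ'⟩ := exists_fidelity_prodDist_eq_sibsonSum ha ha' P W
    exact fidelity_prodDist_power_le_of_sibsonSum_le ha ha' (hQ' ▸ hs Q') n Q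

end Multiplicativity

end Converse

-- Mutual information as the derivative of Sibson's sum at order 1.

section MutualInformation

section Calculus

/-- The case `w = 0` is included: `0 ^ b = 0` for `b` near 1, and `0 * log 0 = 0`. -/
theorem hasDerivAt_const_rpow_one {w : ℝ} (hw : 0 ≤ w) :
    HasDerivAt (fun b : ℝ => w ^ b) (w * Real.log w) 1 := by
  rcases hw.eq_or_lt with rfl | hw
  · rw [zero_mul]
    refine (hasDerivAt_const (1 : ℝ) (0 : ℝ)).congr_of_eventuallyEq ?_
    filter_upwards [lt_mem_nhds one_pos] with b hb
    exact Real.zero_rpow (ne_of_gt hb)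
  · simpa using (Real.hasStrictDerivAt_const_rpow hw 1).hasDerivAt

/-- Both sides equal 1 at `b = 1`, and there the right side has the larger derivative. -/
theorem eventually_lt_exp_right {f : ℝ → ℝ} {J u : ℝ} (hf : HasDerivAt f J 1) (h1 : f 1 = 1)
    (hu : J < u) : ∀ᶠ b in 𝓝[>] (1 : ℝ), f b < Real.exp (u * (b - 1)) := by
  have hd : HasDerivAt (fun b => f b - Real.exp (u * (b - 1))) (J - u) 1 := by
    have := (((hasDerivAt_id (1 : ℝ)).sub_const 1).const_mul u).exp
    exact (hf.fun_sub this).congr_deriv (by simp)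
  have := (hasDerivAt_iff_tendsto_slope.1 hd).eventually_lt_const (sub_neg.2 hu)
  have h2 := this.filter_mono (nhdsWithin_mono 1 fun b (hb : 1 < b) => hb.ne')
  filter_upwards [h2, self_mem_nhdsWithin] with b hb (hb1 : 1 < b)
  simp only [slope_def_field, h1, sub_self, mul_zero, Real.exp_zero, sub_zero] at hb
  have := (div_neg_iff.1 hb).resolve_left (fun h => by linarith [h.2])
  linarith [this.1]

theorem eventually_lt_exp_left {f : ℝ → ℝ} {J u : ℝ} (hf : HasDerivAt f J 1) (h1 : f 1 = 1)
    (hu : u < J) : ∀ᶠ b in 𝓝[<] (1 : ℝ), f b < Real.exp (u * (b - 1)) := by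
  have hd : HasDerivAt (fun b => f b - Real.exp (u * (b - 1))) (J - u) 1 := by
    have := (((hasDerivAt_id (1 : ℝ)).sub_const 1).const_mul u).exp
    exact (hf.fun_sub this).congr_deriv (by simp)
  have := (hasDerivAt_iff_tendsto_slope.1 hd).eventually_const_lt (sub_pos.2 hu)
  have h2 := this.filter_mono (nhdsWithin_mono 1 fun b (hb : b < 1) => hb.ne)
  filter_upwards [h2, self_mem_nhdsWithin] with b hb (hb1 : b < 1)
  simp only [slope_def_field, h1, sub_self, mul_zero, Real.exp_zero, sub_zero] at hb
  have := (div_pos_iff.1 hb).resolve_left (fun h => by linarith [h.2])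
  linarith [this.1]

end Calculus

theorem fidelity_one_eq_exp {A : Type*} [Fintype A] {P Q : A → ℝ≥0∞} (hP : ∀ x, P x ≠ ∞)
    (hQ : ∀ x, Q x ≠ ∞) (hPQ : ∀ x, Q x = 0 → P x = 0) :
    fidelity 1 P Q = ENNReal.ofReal (Real.exp
      (∑ x, (P x).toReal * (Real.log (Q x).toReal - Real.log (P x).toReal))) := by
  rw [fidelity_one, Real.exp_sum, ENNReal.ofReal_prod_of_nonneg fun _ _ => (Real.exp_pos _).le]
  refine Finset.prod_congr rfl fun x _ => ?_
  by_cases hx : P x = 0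
  · simp [hx]
  have hp := ENNReal.toReal_pos hx (hP x)
  have hq := ENNReal.toReal_pos (mt (hPQ x) hx) (hQ x)
  rw [← Real.log_div hq.ne' hp.ne', mul_comm, ← Real.rpow_def_of_pos (div_pos hq hp),
    ← ENNReal.ofReal_rpow_of_pos (div_pos hq hp), ENNReal.ofReal_div_of_pos hp,
    ENNReal.ofReal_toReal (hQ x), ENNReal.ofReal_toReal (hP x)]

variable {X Y : Type*}

theorem PMF_bind_toReal [Fintype X] (P : PMF X) (W : Channel X Y) (y : Y) :
    (P.bind W y).toReal = ∑ x, (P x).toReal * (W x y).toReal := by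
  rw [PMF.bind_apply, tsum_fintype, ENNReal.toReal_sum fun x _ =>
    ENNReal.mul_ne_top (P.apply_ne_top x) ((W x).apply_ne_top y)]
  simp only [ENNReal.toReal_mul]

variable [Fintype X] [Fintype Y]

theorem fidelity_one_joint_eq_exp (P : PMF X) (W M : Channel X Y)
    (h : ∀ x y, P x ≠ 0 → M x y = 0 → W x y = 0) :
    fidelity 1 (joint P W) (joint P M) = ENNReal.ofReal (Real.exp (-
      ∑ x, (P x).toReal * ∑ y, (W x y).toReal *
        (Real.log (W x y).toReal - Real.log (M x y).toReal))) := by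
  rw [fidelity_one_eq_exp (joint_ne_top P W) (joint_ne_top P M)]
  · congr 2
    simp only [Fintype.sum_prod_type, joint, ENNReal.toReal_mul, Finset.mul_sum,
      ← Finset.sum_neg_distrib]
    refine Finset.sum_congr rfl fun x _ => Finset.sum_congr rfl fun y _ => ?_
    by_cases hP : P x = 0
    · simp [hP]
    by_cases hW : W x y = 0
    · simp [hW]
    have hp := ENNReal.toReal_pos hP (P.apply_ne_top x)
    have hw := ENNReal.toReal_pos hW ((W x).apply_ne_top y)
    have hm := ENNReal.toReal_pos (mt (h x y hP) hW) ((M x).apply_ne_top y)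
    rw [Real.log_mul hp.ne' hw.ne', Real.log_mul hp.ne' hm.ne']
    ring
  · intro p hp
    rcases mul_eq_zero.1 hp with hp | hp
    · simp [joint, hp]
    · by_cases hP : P p.1 = 0
      · simp [joint, hP]
      · simp [joint, h _ _ hP hp]

theorem ofReal_two_rpow_neg (t : ℝ) :
    ENNReal.ofReal (2 ^ (-t)) = ENNReal.ofReal (Real.exp (-(t * Real.log 2))) := by
  rw [Real.rpow_def_of_pos two_pos]
  congr 2
  ring

theorem lt_mutualInfo_iff (P : PMF X) (W : Channel X Y) (t : ℝ) :
    t < mutualInfo P W ↔ t * Real.log 2 < ∑ x, (P x).toReal * ∑ y, (W x y).toReal *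
        (Real.log (W x y).toReal - Real.log (P.bind W y).toReal) := by
  rw [mutualInfo, lt_renyiDiv_iff, prodDist_eq_joint, fidelity_one_joint_eq_exp,
    ofReal_two_rpow_neg, ENNReal.ofReal_lt_ofReal_iff (Real.exp_pos _), Real.exp_lt_exp,
    neg_lt_neg_iff]
  intro x y hx hy
  rw [PMF.bind_apply, tsum_fintype, Finset.sum_eq_zero_iff] at hy
  exact (mul_eq_zero.1 (hy x (Finset.mem_univ x))).resolve_left hx

/-- Sibson's sum as a real number. -/
def realSibsonSum (P : PMF X) (W : Channel X Y) (b : ℝ) : ℝ :=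
  ∑ y, (∑ x, (P x).toReal * (W x y).toReal ^ b) ^ (1 / b)

theorem sibsonSum_eq_ofReal {b : ℝ} (hb : 0 < b) (P : PMF X) (W : Channel X Y) :
    sibsonSum b P W = ENNReal.ofReal (realSibsonSum P W b) := by
  rw [← ENNReal.ofReal_toReal (sibsonSum_ne_top hb P W), sibsonSum, realSibsonSum]
  rw [ENNReal.toReal_sum fun y _ => ENNReal.rpow_ne_top_of_nonneg (by positivity)
    (sum_mul_rpow_ne_top hb P W y)]
  congr 1
  refine Finset.sum_congr rfl fun y _ => ?_
  rw [← ENNReal.toReal_rpow, ENNReal.toReal_sum fun x _ => ENNReal.mul_ne_top (P.apply_ne_top x)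
    (ENNReal.rpow_ne_top_of_nonneg hb.le ((W x).apply_ne_top y))]
  simp only [ENNReal.toReal_mul, ENNReal.toReal_rpow]

theorem hasDerivAt_realSibsonSum (P : PMF X) (W : Channel X Y) :
    HasDerivAt (realSibsonSum P W) (∑ x, (P x).toReal * ∑ y, (W x y).toReal *
        (Real.log (W x y).toReal - Real.log (P.bind W y).toReal)) 1 := by
  have key : ∀ y, HasDerivAt (fun b : ℝ => (∑ x, (P x).toReal * (W x y).toReal ^ b) ^ (1 / b))
      (∑ x, (P x).toReal * ((W x y).toReal * Real.log (W x y).toReal) -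
        (P.bind W y).toReal * Real.log (P.bind W y).toReal) 1 := by
    intro y
    have hq := PMF_bind_toReal P W y
    set q := (P.bind W y).toReal
    have hg : HasDerivAt (fun b : ℝ => ∑ x, (P x).toReal * (W x y).toReal ^ b)
        (∑ x, (P x).toReal * ((W x y).toReal * Real.log (W x y).toReal)) 1 :=
      HasDerivAt.fun_sum fun x _ =>
        (hasDerivAt_const_rpow_one ENNReal.toReal_nonneg).const_mul (P x).toReal
    rcases (ENNReal.toReal_nonneg : 0 ≤ q).eq_or_lt with h0 | hpos
    -- An output of probability zero contributes the constant 0 for `b > 0`; the chain rule for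
    -- powers is unavailable at base 0.
    · have hz : ∀ x, (P x).toReal * (W x y).toReal = 0 := by
        intro x
        exact (Finset.sum_eq_zero_iff_of_nonneg fun x _ =>
          mul_nonneg ENNReal.toReal_nonneg ENNReal.toReal_nonneg).1 (hq.symm.trans h0.symm) x
            (Finset.mem_univ x)
      have : ∑ x, (P x).toReal * ((W x y).toReal * Real.log (W x y).toReal) - q * Real.log q
          = 0 := by
        rw [show q = 0 from h0.symm, zero_mul, sub_zero]
        refine Finset.sum_eq_zero fun x _ => ?_
        rw [← mul_assoc, hz, zero_mul]
      rw [this]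
      refine (hasDerivAt_const (1 : ℝ) (0 : ℝ)).congr_of_eventuallyEq ?_
      filter_upwards [lt_mem_nhds one_pos] with b hb
      have : ∑ x, (P x).toReal * (W x y).toReal ^ b = 0 := by
        refine Finset.sum_eq_zero fun x _ => ?_
        rcases mul_eq_zero.1 (hz x) with h | h
        · rw [h, zero_mul]
        · rw [h, Real.zero_rpow (ne_of_gt hb), mul_zero]
      rw [this, Real.zero_rpow (one_div_pos.2 hb).ne']
    · have h1 : ∑ x, (P x).toReal * (W x y).toReal ^ (1 : ℝ) = q := by simp [hq]
      have hinv : HasDerivAt (fun b : ℝ => 1 / b) (-1) 1 := by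
        simpa using hasDerivAt_inv (one_ne_zero (α := ℝ))
      have := hg.rpow hinv (by rw [h1]; exact hpos)
      convert this using 1
      rw [h1]
      simp
      ring
  have : HasDerivAt (realSibsonSum P W) _ 1 :=
    HasDerivAt.fun_sum (u := Finset.univ) fun y _ => key y
  refine this.congr_deriv (Eq.symm ?_)
  simp only [Finset.mul_sum, mul_sub, Finset.sum_sub_distrib]
  congr 1
  · rw [Finset.sum_comm]
  · rw [Finset.sum_comm]
    refine Finset.sum_congr rfl fun y _ => ?_
    rw [PMF_bind_toReal, Finset.sum_mul]
    simp only [mul_assoc]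

theorem realSibsonSum_one (P : PMF X) (W : Channel X Y) : realSibsonSum P W 1 = 1 := by
  simp only [realSibsonSum, Real.rpow_one, div_one, ← PMF_bind_toReal]
  exact sum_toReal_eq_one (PMF_sum_coe _)

/-- As the order increases to `1`, the Rényi mutual information exceeds any number below the
mutual information. -/
theorem exists_sibsonSum_rpow_le {P : PMF X} {W : Channel X Y} {t a : ℝ} (ht : t < mutualInfo P W)
    (ha : a < 1) :
    ∃ b, 0 < b ∧ a < b ∧ b < 1 ∧
      sibsonSum b P W ^ (b / (1 - b)) ≤ ENNReal.ofReal (2 ^ (-t)) := by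
  -- The bound obtained below is `exp (-(u * b))`; the gap between `t * log 2` and `u` absorbs the
  -- factor `b < 1`.
  obtain ⟨u, htu, hu⟩ := exists_between ((lt_mutualInfo_iff P W t).1 ht)
  have h1 := eventually_lt_exp_left (hasDerivAt_realSibsonSum P W) (realSibsonSum_one P W) hu
  have h2 : ∀ᶠ b in 𝓝[<] (1 : ℝ), t * Real.log 2 < u * b := by
    have : Tendsto (fun b : ℝ => u * b) (𝓝 1) (𝓝 (u * 1)) := tendsto_id.const_mul u
    exact (this.eventually_const_lt (by simpa using htu)).filter_mono nhdsWithin_le_nhds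
  have h3 : ∀ᶠ b in 𝓝[<] (1 : ℝ), max a 0 < b :=
    (lt_mem_nhds (max_lt ha one_pos)).filter_mono nhdsWithin_le_nhds
  obtain ⟨b, hb1, hb2, hb3, hb4⟩ :=
    (h1.and (h2.and (h3.and self_mem_nhdsWithin))).exists
  have hb0 : 0 < b := (le_max_right a 0).trans_lt hb3
  have hb1' : 0 < 1 - b := sub_pos.2 hb4
  refine ⟨b, hb0, (le_max_left a 0).trans_lt hb3, hb4, ?_⟩
  rw [sibsonSum_eq_ofReal hb0, ofReal_two_rpow_neg]
  calc ENNReal.ofReal (realSibsonSum P W b) ^ (b / (1 - b))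
      ≤ ENNReal.ofReal (Real.exp (u * (b - 1))) ^ (b / (1 - b)) := by
        gcongr
    _ = ENNReal.ofReal (Real.exp (-(u * b))) := by
        rw [ENNReal.ofReal_rpow_of_pos (Real.exp_pos _), ← Real.exp_mul]
        congr 2
        field_simp
        ring
    _ ≤ _ := ENNReal.ofReal_le_ofReal (Real.exp_le_exp.2 (by linarith))

end MutualInformation

-- Lower bounds on the simulation rate.

section ConverseRate

variable {X Y : Type*} [Fintype X] [Fintype Y]

/-- Vanishing performance is eventually below 1, that is, some simulation has fidelity at least 1/2;
the constant `κ` costs only `log κ / n` in the rate. -/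
theorem le_renyiSimulationRate_of_forall {α : ℝ≥0∞} {W : Channel X Y} {t κ : ℝ} (hκ : 0 < κ)
    (h : ∀ (n : ℕ) (c : ℝ) (M : Channel (Fin n → X) (Fin n → Y)),
      M ∈ simulations (Fin n → X) (Fin n → Y) c →
      (∀ P : PMF (Fin n → X),
        ENNReal.ofReal (2 ^ (-1 : ℝ)) ≤ fidelity α (joint P (W.power n)) (joint P M)) →
      κ * 2 ^ (n * t) ≤ (2 : ℝ) ^ c) :
    (t : EReal) ≤ renyiSimulationRate α W := by
  refine le_sInf ?_
  rintro _ ⟨c, -, hlim, rfl⟩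
  have hev : ∀ᶠ n in atTop, simPerformance α (W.power n) (c n) < 1 :=
    eventually_lt_of_limsup_lt (by rw [hlim]; exact zero_lt_one)
  have hle : ∀ᶠ n : ℕ in atTop, ((Real.logb 2 κ / n + t : ℝ) : EReal) ≤ ((c n / n : ℝ) : EReal) := by
    filter_upwards [hev, eventually_gt_atTop 0] with n hn hn0
    simp only [simPerformance, iInf_lt_iff] at hn
    obtain ⟨M, hM, hlt⟩ := hn
    have h1 := h n (c n) M hM fun P => renyiDiv_le_iff.1 ((le_iSup _ P).trans hlt.le)
    have h2 := Real.logb_le_logb_of_le one_lt_two (by positivity) h1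
    rw [Real.logb_mul hκ.ne' (by positivity), Real.logb_rpow two_pos (by norm_num),
      Real.logb_rpow two_pos (by norm_num)] at h2
    have hn' : (0 : ℝ) < n := by exact_mod_cast hn0
    refine EReal.coe_le_coe_iff.2 ?_
    rw [div_add' _ _ _ hn'.ne']
    gcongr
    linarith
  have htend : Tendsto (fun n : ℕ => ((Real.logb 2 κ / n + t : ℝ) : EReal)) atTop (𝓝 (t : EReal)) := by
    refine EReal.tendsto_coe.2 ?_
    simpa using (tendsto_const_div_atTop_nhds_zero_nat (Real.logb 2 κ)).add_const t
  rw [← htend.limsup_eq]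
  exact limsup_le_limsup hle

theorem mul_two_rpow_le_of_ofReal_le {κ c t : ℝ} {n : ℕ}
    (h : ENNReal.ofReal κ ≤ ENNReal.ofReal (2 ^ c) * ENNReal.ofReal (2 ^ (-t)) ^ n) :
    κ * 2 ^ (n * t) ≤ (2 : ℝ) ^ c := by
  rw [← ENNReal.ofReal_pow (by positivity), ← ENNReal.ofReal_mul (by positivity),
    ENNReal.ofReal_le_ofReal_iff (by positivity), ← Real.rpow_mul_natCast (by norm_num)] at h
  calc κ * 2 ^ (n * t) ≤ 2 ^ c * 2 ^ (-t * n) * 2 ^ (n * t) := by gcongr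
    _ = 2 ^ c := by
      rw [mul_assoc, ← Real.rpow_add two_pos]
      simp [mul_comm]

theorem renyiCapacity_le_renyiSimulationRate {α : ℝ≥0∞} (hα : α ≠ 1) (W : Channel X Y) :
    renyiCapacity α W ≤ renyiSimulationRate α W := by
  refine EReal.ge_of_forall_gt_iff_ge.1 fun t ht => ?_
  obtain ⟨P, hP⟩ := lt_iSup_iff.1 ht
  refine le_renyiSimulationRate_of_forall (κ := 2 ^ (-1 : ℝ)) (by positivity) fun n c M hM h => ?_
  refine mul_two_rpow_le_of_ofReal_le ((h (iid P n)).trans ?_)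
  refine fidelity_joint_le_of_mem_simulations hM (fidelity_prodDist_power_le hα (fun Q => ?_) n)
  exact (lt_renyiDiv_iff.1 (hP.trans_le (iInf_le _ Q))).le

theorem shannonCapacity_le_renyiSimulationRate {α : ℝ≥0∞} (hα : 0 < α) (hα' : α ≤ 1)
    (W : Channel X Y) : shannonCapacity W ≤ renyiSimulationRate α W := by
  refine EReal.ge_of_forall_gt_iff_ge.1 fun t ht => ?_
  obtain ⟨P, hP⟩ := lt_iSup_iff.1 ht
  -- Order 1 is reduced to order 1/2, whose fidelity is larger; an order below 1 is kept.
  obtain ⟨a, ha, ha', hle⟩ : ∃ a : ℝ, 0 < a ∧ a < 1 ∧ ∀ (n : ℕ) (M : Channel (Fin n → X) (Fin n → Y)),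
      fidelity α (joint (iid P n) (W.power n)) (joint (iid P n) M) ≤
        fidelity (ENNReal.ofReal a) (joint (iid P n) (W.power n)) (joint (iid P n) M) := by
    rcases hα'.eq_or_lt with rfl | h1
    · exact ⟨1 / 2, by norm_num, by norm_num, fun n M => fidelity_one_le_of_lt_one (sum_joint _ _)
        (joint_ne_top _ _) (by norm_num) (by norm_num)⟩
    · have ht : α ≠ ∞ := (h1.trans ENNReal.one_lt_top).ne
      refine ⟨α.toReal, ENNReal.toReal_pos hα.ne' ht, ?_, fun n M => ?_⟩
      · rw [← ENNReal.toReal_one]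
        exact (ENNReal.toReal_lt_toReal ht ENNReal.one_ne_top).2 h1
      · rw [ENNReal.ofReal_toReal ht]
  obtain ⟨b, hb, hab, hb', hs⟩ := exists_sibsonSum_rpow_le hP ha'
  set e := (1 - b) * (a / b) with he
  have he0 : 0 < e := mul_pos (sub_pos.2 hb') (div_pos ha hb)
  -- If `F_a ≥ 1/2`, then `(1/2)^(1-a) ≤ F_b^e` by `fidelity_rpow_le_of_lt`; solving for `F_b` gives
  -- `κ`.
  refine le_renyiSimulationRate_of_forall (κ := ((2 ^ (-1 : ℝ)) ^ (1 - a)) ^ e⁻¹) (by positivity)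
    fun n c M hM h => mul_two_rpow_le_of_ofReal_le ?_
  refine le_trans ?_ (fidelity_joint_le_of_mem_simulations hM
    (fidelity_prodDist_power_le_of_sibsonSum_le hb hb'.ne hs n))
  rw [← ENNReal.ofReal_rpow_of_pos (by positivity), ← ENNReal.ofReal_rpow_of_pos (by positivity),
    ENNReal.rpow_inv_le_iff he0]
  refine le_trans ?_ (fidelity_rpow_le_of_lt (sum_joint _ _) ha hab hb')
  exact ENNReal.rpow_le_rpow ((h (iid P n)).trans (hle n M)) (by linarith)

end ConverseRate

-- Rejection sampling and the general achievability bound.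

section Sampling

section RejectionSampling

variable {X Y : Type*}

/-- `M` can be realized with `N` messages and shared randomness. -/
def IsSimulatedBy (N : ℕ) (M : Channel X Y) : Prop :=
  ∃ (K : Type) (_ : Fintype K) (PK : PMF K)
    (E : Channel (X × K) (Fin N)) (D : Channel (Fin N × K) Y),
    ∀ x y, M x y = ∑ k, ∑ j, PK k * E (x, k) j * D (j, k) y

theorem IsSimulatedBy.mem_simulations {N : ℕ} {M : Channel X Y} (h : IsSimulatedBy N M)
    (hN : 1 ≤ N) {c : ℝ} (hc : Real.logb 2 N ≤ c) : M ∈ simulations X Y c :=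
  ⟨N, hN, hc, h⟩

theorem isSimulatedBy_const (Q : PMF Y) : IsSimulatedBy 1 (fun _ : X => Q) :=
  ⟨Unit, inferInstance, PMF.pure (), fun _ => PMF.pure 0, fun _ => Q, fun x y => by simp⟩

/-- One more message allows the sender to accept or reject one more shared sample of `Q`. -/
theorem IsSimulatedBy.succ [Fintype Y] {N : ℕ} {M L : Channel X Y} (h : IsSimulatedBy N M)
    {Q : PMF Y} {A : ℝ≥0∞} (hA : A ≠ 0) (hA' : A ≠ ∞) (hL : ∀ x y, L x y ≤ A * Q y) :
    ∃ M' : Channel X Y, IsSimulatedBy (N + 1) M' ∧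
      ∀ x y, M' x y = A⁻¹ * L x y + (1 - A⁻¹) * M x y := by
  classical
  obtain ⟨K, _, PK, E, D, hM⟩ := h
  -- The shared randomness must live in `Type`, so the shared sample is recorded as an index in
  -- `Fin`.
  let e := Fintype.equivFin Y
  -- Acceptance probability of the sample `y`: an accepted sample has law `L x`, and acceptance has
  -- total probability `A⁻¹`.
  let a : X → Y → ℝ≥0∞ := fun x y => L x y / (A * Q y)
  have ha : ∀ x y, a x y ≤ 1 := fun x y => ENNReal.div_le_of_le_mul (by rw [one_mul]; exact hL x y)
  have hQa : ∀ x y, Q y * a x y = A⁻¹ * L x y := by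
    intro x y
    by_cases hQ : Q y = 0
    · have : L x y = 0 := by simpa [hQ] using hL x y
      simp [hQ, this]
    · simp only [a]
      rw [div_eq_mul_inv, ENNReal.mul_inv (.inl hA) (.inl hA'), mul_comm A⁻¹, mul_left_comm,
        ← mul_assoc (Q y), ENNReal.mul_inv_cancel hQ (Q.apply_ne_top y), one_mul, mul_comm]
  have hsum : ∀ x, ∑ y, Q y * a x y = A⁻¹ := by
    intro x
    simp_rw [hQa]
    rw [← Finset.mul_sum, PMF_sum_coe, mul_one]
  have hsum' : ∀ x, ∑ y, Q y * (1 - a x y) = 1 - A⁻¹ := by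
    intro x
    refine ENNReal.eq_sub_of_add_eq (ENNReal.inv_ne_top.2 hA) ?_
    rw [← hsum x, ← Finset.sum_add_distrib]
    refine (Finset.sum_congr rfl fun y _ => ?_).trans (PMF_sum_coe Q)
    rw [← mul_add, tsub_add_cancel_of_le (ha x y), mul_one]
  have hA1 : X → A⁻¹ ≤ 1 := by
    intro x
    rw [← hsum x, ← PMF_sum_coe Q]
    exact Finset.sum_le_sum fun y _ => mul_le_of_le_one_right' (ha x y)
  -- Message 0 announces acceptance and the receiver outputs the shared sample; after a rejection
  -- the old protocol runs with its messages shifted by one.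
  refine ⟨fun x => PMF.ofFintype (fun y => A⁻¹ * L x y + (1 - A⁻¹) * M x y) ?_,
    ⟨Fin (Fintype.card Y) × K, inferInstance,
      PMF.ofFintype (fun k => Q (e.symm k.1) * PK k.2) ?_,
      fun p => PMF.ofFintype (Fin.cons (a p.1 (e.symm p.2.1))
        fun j => (1 - a p.1 (e.symm p.2.1)) * E (p.1, p.2.2) j) ?_,
      fun p => Fin.cases (PMF.pure (e.symm p.2.1)) (fun j => D (j, p.2.2)) p.1, ?_⟩,
    fun x y => rfl⟩
  · rw [Finset.sum_add_distrib, ← Finset.mul_sum, ← Finset.mul_sum, PMF_sum_coe, PMF_sum_coe,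
      mul_one, mul_one, add_tsub_cancel_of_le (hA1 x)]
  · simp only [Fintype.sum_prod_type, ← Finset.mul_sum, PMF_sum_coe, mul_one]
    rw [e.symm.sum_comp (fun y => Q y), PMF_sum_coe]
  · rw [Fin.sum_univ_succ]
    simp only [Fin.cons_zero, Fin.cons_succ, ← Finset.mul_sum, PMF_sum_coe, mul_one]
    exact add_tsub_cancel_of_le (ha _ _)
  · intro x y
    simp only [PMF.ofFintype_apply, Fintype.sum_prod_type, Fin.sum_univ_succ, Fin.cons_zero,
      Fin.cons_succ, Fin.cases_zero, Fin.cases_succ]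
    rw [e.symm.sum_comp (fun z => ∑ k, (Q z * PK k * a x z * PMF.pure z y +
      ∑ j, Q z * PK k * ((1 - a x z) * E (x, k) j) * D (j, k) y))]
    simp only [Finset.sum_add_distrib]
    congr 1
    · rw [← hQa, Finset.sum_eq_single y]
      · simp only [PMF.pure_apply_self, mul_one, ← Finset.sum_mul, ← Finset.mul_sum, PMF_sum_coe]
      · intro z _ hz
        simp [PMF.pure_apply, hz.symm]
      · simp
    · rw [← hsum' x, Finset.sum_mul, hM]
      refine Finset.sum_congr rfl fun z _ => ?_
      simp only [Finset.mul_sum]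
      refine Finset.sum_congr rfl fun k _ => Finset.sum_congr rfl fun j _ => ?_
      ring

/-- Rejection sampling. -/
theorem exists_isSimulatedBy_ge [Fintype Y] {L : Channel X Y} {Q : PMF Y} {A : ℝ≥0∞} (hA : 1 ≤ A)
    (hA' : A ≠ ∞) (hL : ∀ x y, L x y ≤ A * Q y) (m : ℕ) :
    ∃ M : Channel X Y, IsSimulatedBy (m + 1) M ∧
      ∀ x y, (1 - (1 - A⁻¹) ^ m) * L x y ≤ M x y := by
  induction m with
  | zero => exact ⟨fun _ => Q, isSimulatedBy_const Q, fun x y => by simp⟩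
  | succ m ih =>
    obtain ⟨M, hM, hle⟩ := ih
    obtain ⟨M', hM', heq⟩ := hM.succ (zero_lt_one.trans_le hA).ne' hA' hL
    refine ⟨M', hM', fun x y => ?_⟩
    have hA1 : A⁻¹ ≤ 1 := ENNReal.inv_le_one.2 hA
    set r := 1 - A⁻¹ with hr
    have hr1 : r ≤ 1 := tsub_le_self
    have key : 1 - r ^ (m + 1) ≤ A⁻¹ + r * (1 - r ^ m) := by
      rw [tsub_le_iff_right, add_assoc, pow_succ', ← mul_add,
        tsub_add_cancel_of_le (pow_le_one₀ zero_le hr1), mul_one, hr, add_tsub_cancel_of_le hA1]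
    rw [heq]
    calc (1 - r ^ (m + 1)) * L x y ≤ (A⁻¹ + r * (1 - r ^ m)) * L x y := by gcongr
      _ = A⁻¹ * L x y + r * ((1 - r ^ m) * L x y) := by ring
      _ ≤ _ := by
        gcongr
        exact hle x y

end RejectionSampling

variable {X Y : Type*} [Fintype X] [Fintype Y]

theorem renyiDiv_joint_nonneg (α : ℝ≥0∞) (P : PMF X) (W M : Channel X Y) :
    0 ≤ renyiDiv α (joint P W) (joint P M) := by
  have : ((0 : ℝ) : EReal) ≤ renyiDiv α (joint P W) (joint P M) := by
    rw [le_renyiDiv_iff]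
    simpa using fidelity_le_one α (sum_joint P W) (sum_joint P M)
  exact_mod_cast this

theorem simPerformance_nonneg [Nonempty X] (α : ℝ≥0∞) (W : Channel X Y) (c : ℝ) :
    0 ≤ simPerformance α W c := by
  obtain ⟨x⟩ := ‹Nonempty X›
  exact le_iInf₂ fun M _ => (renyiDiv_joint_nonneg α (PMF.pure x) W M).trans
    (le_iSup (fun P => renyiDiv α (joint P W) (joint P M)) (PMF.pure x))

/-- Rejection sampling dominates `η L` with `η = 1 - (1 - A⁻¹) ^ m`, so by monotonicity and
homogeneity it costs only the factor `η` in fidelity. -/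
theorem simPerformance_le {α : ℝ≥0∞} {W L : Channel X Y} {Q : PMF Y} {A θ : ℝ≥0∞} (hA : 1 ≤ A)
    (hA' : A ≠ ∞) (hL : ∀ x y, L x y ≤ A * Q y)
    (hθ : ∀ P : PMF X, θ ≤ fidelity α (joint P W) (joint P L)) {m : ℕ} {c ε : ℝ}
    (hc : Real.logb 2 (m + 1 : ℕ) ≤ c)
    (hε : ENNReal.ofReal (2 ^ (-ε)) ≤ (1 - (1 - A⁻¹) ^ m) * θ) :
    simPerformance α W c ≤ ε := by
  obtain ⟨M, hM, hle⟩ := exists_isSimulatedBy_ge hA hA' hL m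
  refine iInf₂_le_of_le M (hM.mem_simulations (Nat.le_add_left 1 m) hc) (iSup_le fun P => ?_)
  rw [renyiDiv_le_iff]
  set η := 1 - (1 - A⁻¹) ^ m
  have hη : η ≠ 0 := by
    rintro h
    rw [h, zero_mul, nonpos_iff_eq_zero, ENNReal.ofReal_eq_zero] at hε
    exact absurd hε (not_le.2 (by positivity))
  have hη' : η ≠ ∞ := (tsub_le_self.trans_lt ENNReal.one_lt_top).ne
  calc ENNReal.ofReal (2 ^ (-ε)) ≤ η * θ := hε
    _ ≤ η * fidelity α (joint P W) (joint P L) := mul_le_mul_right (hθ P) _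
    _ = fidelity α (joint P W) (fun p => η * joint P L p) :=
        (fidelity_const_mul_right α (sum_joint P W) _ hη hη').symm
    _ ≤ _ := fidelity_mono_right _ _ fun p => by
        rw [joint, joint, mul_left_comm]
        exact mul_le_mul_right (hle _ _) _

/-- By `1 - x ≤ exp (-x)`, the rejection probability decays like `exp (-(b / a) ^ n / 2)`. One of
the `⌊b ^ n⌋₊` messages is reserved for the fallback, whence the `- 1`. -/
theorem tendsto_one_sub_inv_pow {a b : ℝ} (ha : 1 ≤ a) (hab : a < b) :
    Tendsto (fun n : ℕ => (1 - (ENNReal.ofReal (2 * a ^ n))⁻¹) ^ (⌊b ^ n⌋₊ - 1)) atTop (𝓝 0) := by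
  have ha0 : 0 < a := by linarith
  have hb0 : 0 < b := by linarith
  have hlim : Tendsto (fun n : ℕ => Real.exp (1 - (b / a) ^ n / 2)) atTop (𝓝 0) := by
    refine Real.tendsto_exp_atBot.comp (tendsto_const_nhds.add_atBot ?_)
    refine tendsto_neg_atTop_atBot.comp ?_
    exact (tendsto_pow_atTop_atTop_of_one_lt ((one_lt_div ha0).2 hab)).atTop_div_const two_pos
  have hlim' : Tendsto (fun n : ℕ => ENNReal.ofReal (Real.exp (1 - (b / a) ^ n / 2))) atTop (𝓝 0) := by
    simpa using ENNReal.tendsto_ofReal hlim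
  refine tendsto_of_tendsto_of_tendsto_of_le_of_le tendsto_const_nhds hlim' (fun _ => zero_le)
    fun n => ?_
  have han : 1 ≤ a ^ n := one_le_pow₀ ha
  have hbn : 1 ≤ b ^ n := one_le_pow₀ (by linarith)
  have hpos : (0 : ℝ) < 2 * a ^ n := by positivity
  have hle1 : (2 * a ^ n)⁻¹ ≤ 1 := inv_le_one_of_one_le₀ (by linarith)
  change (1 - (ENNReal.ofReal (2 * a ^ n))⁻¹) ^ (⌊b ^ n⌋₊ - 1) ≤ _
  rw [← ENNReal.ofReal_inv_of_pos hpos, ← ENNReal.ofReal_one,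
    ← ENNReal.ofReal_sub _ (inv_nonneg.2 hpos.le), ← ENNReal.ofReal_pow (by linarith)]
  refine ENNReal.ofReal_le_ofReal ?_
  have hfl : b ^ n - 2 ≤ ((⌊b ^ n⌋₊ - 1 : ℕ) : ℝ) := by
    rw [Nat.cast_sub (Nat.one_le_floor_iff _ |>.2 hbn), Nat.cast_one]
    linarith [Nat.lt_floor_add_one (b ^ n)]
  calc (1 - (2 * a ^ n)⁻¹) ^ (⌊b ^ n⌋₊ - 1)
      ≤ Real.exp (-(2 * a ^ n)⁻¹) ^ (⌊b ^ n⌋₊ - 1) := by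
        gcongr
        exact Real.one_sub_le_exp_neg _
    _ = Real.exp (-((⌊b ^ n⌋₊ - 1 : ℕ) * (2 * a ^ n)⁻¹)) := by
        rw [← Real.exp_nat_mul, mul_neg]
    _ ≤ _ := by
        refine Real.exp_le_exp.2 ?_
        have h1 : (b ^ n - 2) * (2 * a ^ n)⁻¹ ≤ (⌊b ^ n⌋₊ - 1 : ℕ) * (2 * a ^ n)⁻¹ := by gcongr
        have h2 : (b ^ n - 2) * (2 * a ^ n)⁻¹ = (b / a) ^ n / 2 - (a ^ n)⁻¹ := by
          rw [div_pow]
          field_simp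
        have h3 : (a ^ n)⁻¹ ≤ 1 := inv_le_one_of_one_le₀ han
        linarith

/-- Achievability from approximating channels that are dominated by constant ones. -/
theorem renyiSimulationRate_le_of_forall [Nonempty X] {α : ℝ≥0∞} {W : Channel X Y} {R a : ℝ}
    (ha : 1 ≤ a) (haR : a < 2 ^ R) (Q : ∀ n, PMF (Fin n → Y))
    (L : ∀ n, Channel (Fin n → X) (Fin n → Y))
    (hL : ∀ n x y, L n x y ≤ ENNReal.ofReal (2 * a ^ n) * Q n y) {θ : ℕ → ℝ≥0∞}
    (hθ : Tendsto θ atTop (𝓝 1))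
    (hF : ∀ n (P : PMF (Fin n → X)), θ n ≤ fidelity α (joint P (W.power n)) (joint P (L n))) :
    renyiSimulationRate α W ≤ R := by
  have hR : 0 < R := by
    have : (2 : ℝ) ^ (0 : ℝ) < 2 ^ R := by rw [Real.rpow_zero]; linarith
    exact (Real.rpow_lt_rpow_left_iff one_lt_two).1 this
  refine sInf_le ⟨fun n => n * R, fun n => by positivity, le_antisymm ?_ ?_, ?_⟩
  · refine EReal.le_of_forall_lt_iff_le.1 fun ε hε => ?_
    have hε' : (0 : ℝ) < ε := by exact_mod_cast hε
    have hprod : Tendsto (fun n => (1 - (1 - (ENNReal.ofReal (2 * a ^ n))⁻¹) ^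
        (⌊((2 : ℝ) ^ R) ^ n⌋₊ - 1)) * θ n) atTop (𝓝 1) := by
      have h1 := ENNReal.Tendsto.sub (tendsto_const_nhds (x := (1 : ℝ≥0∞)))
        (tendsto_one_sub_inv_pow ha haR) (.inl ENNReal.one_ne_top)
      have h2 := ENNReal.Tendsto.mul h1 (.inl (by simp)) hθ (.inl one_ne_zero)
      simpa using h2
    have hlt : ENNReal.ofReal (2 ^ (-ε)) < 1 := by
      rw [ENNReal.ofReal_lt_one]
      exact Real.rpow_lt_one_of_one_lt_of_neg one_lt_two (by linarith)
    refine limsup_le_of_le (h := ?_)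
    filter_upwards [hprod.eventually_const_lt hlt] with n hn
    have h2R : (1 : ℝ) ≤ ((2 : ℝ) ^ R) ^ n := one_le_pow₀ (by linarith)
    have hfl : 1 ≤ ⌊((2 : ℝ) ^ R) ^ n⌋₊ := (Nat.one_le_floor_iff _).2 h2R
    refine simPerformance_le ?_ ENNReal.ofReal_ne_top (hL n) (hF n) ?_ hn.le
    · rw [ENNReal.one_le_ofReal]
      linarith [one_le_pow₀ ha (n := n)]
    · rw [Nat.sub_add_cancel hfl, Real.logb_le_iff_le_rpow one_lt_two (by exact_mod_cast hfl),
        mul_comm, Real.rpow_mul_natCast (by norm_num)]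
      exact Nat.floor_le (by positivity)
  · exact le_limsup_of_frequently_le
      (Frequently.of_forall fun n => simPerformance_nonneg α _ _)
  · have : (fun n : ℕ => ((n * R / n : ℝ) : EReal)) =ᶠ[atTop] fun _ => (R : EReal) := by
      filter_upwards [eventually_gt_atTop 0] with n hn
      rw [mul_div_cancel_left₀ _ (by exact_mod_cast hn.ne')]
    rw [limsup_congr this, limsup_const]

end Sampling

-- Minimax: one output distribution for all inputs.

section MinimaxTheorem

section Minimax

/-- A minimax theorem for finitely many convex functions. -/
theorem exists_weights_forall_le_sum {X E : Type*} [Fintype X] [AddCommGroup E] [Module ℝ E]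
    {C : Set E} (hC : C.Nonempty) {φ : X → E → ℝ} (hφ : ∀ x, ConvexOn ℝ C (φ x)) {t : ℝ}
    (h : ∀ q ∈ C, ∃ x, t ≤ φ x q) :
    ∃ p : X → ℝ, (∀ x, 0 ≤ p x) ∧ ∑ x, p x = 1 ∧ ∀ q ∈ C, t ≤ ∑ x, p x * φ x q := by
  classical
  obtain ⟨q₀, hq₀⟩ := hC
  -- This set of strict upper bounds is open, convex, and misses the constant vector `t`; a
  -- separating functional, negated, gives the weights up to normalization.
  let A : Set (X → ℝ) := {v | ∃ q ∈ C, ∀ x, φ x q < v x}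
  have hopen : IsOpen A := by
    have : A = ⋃ q ∈ C, Set.univ.pi fun x => Set.Ioi (φ x q) := by
      ext v
      simp [A]
    rw [this]
    exact isOpen_biUnion fun q _ => isOpen_set_pi Set.finite_univ fun x _ => isOpen_Ioi
  have hconv : Convex ℝ A := by
    rintro v ⟨q, hq, hv⟩ w ⟨r, hr, hw⟩ a b ha hb hab
    -- Convexity of `C` is read off from one of the `φ x`; an index exists by `h`.
    refine ⟨a • q + b • r, (hφ (h q hq).choose).1 hq hr ha hb hab, fun x => ?_⟩
    refine ((hφ x).2 hq hr ha hb hab).trans_lt ?_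
    simp only [smul_eq_mul, Pi.add_apply, Pi.smul_apply]
    rcases ha.eq_or_lt with rfl | ha'
    · have : b = 1 := by linarith
      simpa [this] using hw x
    · have h1 := mul_lt_mul_of_pos_left (hv x) ha'
      have h2 := mul_le_mul_of_nonneg_left (hw x).le hb
      linarith
  have hnot : (fun _ => t) ∉ A := by
    rintro ⟨q, hq, hlt⟩
    obtain ⟨x, hx⟩ := h q hq
    exact absurd (hlt x) (not_lt.2 hx)
  obtain ⟨f, hf⟩ := geometric_hahn_banach_open_point hconv hopen hnot
  set p : X → ℝ := fun x => -f (Pi.single x 1) with hp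
  have hfp : ∀ v : X → ℝ, f v = -∑ x, p x * v x := by
    intro v
    conv_lhs => rw [pi_eq_sum_univ' v]
    simp only [map_sum, map_smul, smul_eq_mul, hp, ← Finset.sum_neg_distrib]
    refine Finset.sum_congr rfl fun x _ => ?_
    ring
  simp only [hfp, neg_lt_neg_iff] at hf
  have hmem : ∀ q ∈ C, ∀ w : X → ℝ, (∀ x, 0 < w x) → (fun x => φ x q + w x) ∈ A :=
    fun q hq w hw => ⟨q, hq, fun x => lt_add_of_pos_right _ (hw x)⟩
  have hp0 : ∀ x, 0 ≤ p x := by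
    intro x
    by_contra hx
    push Not at hx
    -- Raising coordinate `x` stays in `A`, so a negative weight would drive the right side below
    -- the separating value.
    have hlin : ∀ s : ℝ, 0 ≤ s →
        ∑ z, p z * t < ∑ z, p z * (φ z q₀ + 1) + s * p x := by
      intro s hs
      have := hf _ (hmem q₀ hq₀ (fun z => 1 + if z = x then s else 0) fun z => by
        split_ifs <;> linarith)
      refine this.trans_eq ?_
      have : ∀ z, p z * (φ z q₀ + (1 + if z = x then s else 0)) =
          p z * (φ z q₀ + 1) + if z = x then s * p x else 0 := by
        intro z
        split_ifs with hz
        · subst hz; ring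
        · ring
      simp [this, Finset.sum_add_distrib]
    set D := ∑ z, p z * (φ z q₀ + 1) - ∑ z, p z * t with hD
    have h0 := hlin 0 le_rfl
    have h1 := hlin (D / (-p x)) (div_nonneg (by linarith) (by linarith))
    have : D / (-p x) * p x = -D := by rw [div_neg, neg_mul, div_mul_cancel₀ _ hx.ne]
    linarith
  have hsum : 0 < ∑ x, p x := by
    refine (Finset.sum_nonneg fun x _ => hp0 x).lt_of_ne' fun h0 => ?_
    have hz : ∀ x, p x = 0 := fun x =>
      (Finset.sum_eq_zero_iff_of_nonneg fun x _ => hp0 x).1 h0 x (Finset.mem_univ x)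
    have := hf _ (hmem q₀ hq₀ 1 fun _ => one_pos)
    simp [hz] at this
  have hle : ∀ q ∈ C, (∑ x, p x) * t ≤ ∑ x, p x * φ x q := by
    intro q hq
    refine le_of_forall_pos_lt_add fun ε hε => ?_
    have := hf _ (hmem q hq (fun _ => ε / ∑ x, p x) fun _ => div_pos hε hsum)
    simp only [mul_add, Finset.sum_add_distrib, ← Finset.sum_mul] at this
    rwa [mul_div_cancel₀ _ hsum.ne'] at this
  refine ⟨fun x => p x / ∑ x, p x, fun x => div_nonneg (hp0 x) hsum.le, ?_, fun q hq => ?_⟩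
  · rw [← Finset.sum_div, div_self hsum.ne']
  · have : ∑ x, p x / (∑ x, p x) * φ x q = (∑ x, p x * φ x q) / ∑ x, p x := by
      rw [Finset.sum_div]
      exact Finset.sum_congr rfl fun x _ => by ring
    rw [this, le_div_iff₀ hsum, mul_comm]
    exact hle q hq

/-- The probability vectors with full support. -/
def posSimplex (Y : Type*) [Fintype Y] : Set (Y → ℝ) := {q | (∀ y, 0 < q y) ∧ ∑ y, q y = 1}

theorem convex_posSimplex (Y : Type*) [Fintype Y] : Convex ℝ (posSimplex Y) := by
  rintro q ⟨hq, hq'⟩ r ⟨hr, hr'⟩ a b ha hb hab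
  refine ⟨fun y => ?_, ?_⟩
  · exact convex_Ioi (0 : ℝ) (hq y) (hr y) ha hb hab
  · simp only [Pi.add_apply, Pi.smul_apply, smul_eq_mul, Finset.sum_add_distrib, ← Finset.mul_sum,
      hq', hr', mul_one, hab]

theorem convexOn_posSimplex_sum {Y : Type*} [Fintype Y] {f : Y → ℝ → ℝ}
    (hf : ∀ y, ConvexOn ℝ (Set.Ioi 0) (f y)) :
    ConvexOn ℝ (posSimplex Y) fun q => ∑ y, f y (q y) := by
  refine ⟨convex_posSimplex Y, fun q hq r hr a b ha hb hab => ?_⟩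
  simp only [smul_eq_mul, Finset.mul_sum, ← Finset.sum_add_distrib]
  exact Finset.sum_le_sum fun y _ => (hf y).2 (hq.1 y) (hr.1 y) ha hb hab

theorem convexOn_rpow_of_nonpos {s : ℝ} (hs : s ≤ 0) :
    ConvexOn ℝ (Set.Ioi 0) fun u : ℝ => u ^ s := by
  refine ⟨convex_Ioi 0, fun u (hu : 0 < u) v (hv : 0 < v) a b ha hb hab => ?_⟩
  have hw : 0 < a • u + b • v := convex_Ioi (0 : ℝ) hu hv ha hb hab
  have h1 := strictConcaveOn_log_Ioi.concaveOn.2 hu hv ha hb hab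
  have h2 := convexOn_exp.2 (Set.mem_univ (Real.log u * s)) (Set.mem_univ (Real.log v * s)) ha hb hab
  simp only [Real.rpow_def_of_pos hu, Real.rpow_def_of_pos hv, Real.rpow_def_of_pos hw]
  refine le_trans (Real.exp_le_exp.2 ?_) h2
  simp only [smul_eq_mul] at h1 ⊢
  nlinarith

variable {X Y : Type*} [Fintype X] [Fintype Y]

/-- The probability distribution with a given real probability vector. -/
def pmfOfReal (p : X → ℝ) (hp : ∀ x, 0 ≤ p x) (hp' : ∑ x, p x = 1) : PMF X :=
  PMF.ofFintype (fun x => ENNReal.ofReal (p x)) (by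
    rw [← ENNReal.ofReal_sum_of_nonneg fun x _ => hp x, hp', ENNReal.ofReal_one])

theorem pmfOfReal_toReal {p : X → ℝ} (hp : ∀ x, 0 ≤ p x) (hp' : ∑ x, p x = 1) (x : X) :
    (pmfOfReal p hp hp' x).toReal = p x := by
  rw [pmfOfReal, PMF.ofFintype_apply, ENNReal.toReal_ofReal (hp x)]

theorem PMF_toReal_mem_posSimplex {Q : PMF Y} (hQ : ∀ y, Q y ≠ 0) :
    (fun y => (Q y).toReal) ∈ posSimplex Y :=
  ⟨fun y => ENNReal.toReal_pos (hQ y) (Q.apply_ne_top y), sum_toReal_eq_one (PMF_sum_coe Q)⟩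

/-- Mixing `Q` with a fraction `ε` of the uniform distribution lowers the fidelity at most by the
factor `1 - ε`. Full support keeps logarithms and negative powers real-valued and convex. -/
theorem fidelity_prodDist_le_of_forall_fullSupport {α s : ℝ≥0∞} {P : PMF X} {W : Channel X Y}
    (h : ∀ Q : PMF Y, (∀ y, Q y ≠ 0) → fidelity α (joint P W) (prodDist P Q) ≤ s) (Q : PMF Y) :
    fidelity α (joint P W) (prodDist P Q) ≤ s := by
  obtain ⟨y₀, -⟩ := Q.support_nonempty
  have : Nonempty Y := ⟨y₀⟩
  have hU : ∀ ε : ℝ≥0∞, 0 < ε → ε < 1 →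
      (1 - ε) * fidelity α (joint P W) (prodDist P Q) ≤ s := by
    intro ε hε hε'
    have hmix : ∑ y, ((1 - ε) * Q y + ε * PMF.uniformOfFintype Y y) = 1 := by
      rw [Finset.sum_add_distrib, ← Finset.mul_sum, ← Finset.mul_sum, PMF_sum_coe, PMF_sum_coe,
        mul_one, mul_one, tsub_add_cancel_of_le hε'.le]
    have hfull : ∀ y, PMF.ofFintype _ hmix y ≠ 0 := by
      intro y
      rw [PMF.ofFintype_apply]
      refine ((ENNReal.mul_pos hε.ne' ?_).trans_le le_add_self).ne'
      simp
    refine le_trans ?_ (h (PMF.ofFintype _ hmix) hfull)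
    rw [← fidelity_const_mul_right α (sum_joint P W) _ (tsub_pos_of_lt hε').ne'
      (tsub_le_self.trans_lt ENNReal.one_lt_top).ne]
    refine fidelity_mono_right _ _ fun p => ?_
    rw [prodDist, prodDist, mul_left_comm, PMF.ofFintype_apply]
    exact mul_le_mul_right le_self_add _
  have hlim : Tendsto (fun n : ℕ => (1 - ((n : ℝ≥0∞) + 2)⁻¹) *
      fidelity α (joint P W) (prodDist P Q)) atTop
      (𝓝 (fidelity α (joint P W) (prodDist P Q))) := by
    have h0 : Tendsto (fun n : ℕ => ((n : ℝ≥0∞) + 2)⁻¹) atTop (𝓝 0) := by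
      have := (tendsto_add_atTop_iff_nat 2).2 ENNReal.tendsto_inv_nat_nhds_zero
      simpa using this
    have h1 := ENNReal.Tendsto.sub (tendsto_const_nhds (x := (1 : ℝ≥0∞))) h0
      (.inl ENNReal.one_ne_top)
    simpa using ENNReal.Tendsto.mul_const h1 (.inl (by simp))
  refine le_of_tendsto' hlim fun n => hU _ (by simp [ENNReal.add_eq_top]) ?_
  rw [ENNReal.inv_lt_one]
  exact lt_of_lt_of_le ENNReal.one_lt_two le_add_self

/-- If every input distribution has small information, then some output distribution is close to
all the conditional distributions of the channel. -/
theorem exists_fullSupport_forall_lt [Nonempty Y] {α s : ℝ≥0∞} {W : Channel X Y}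
    {φ : X → (Y → ℝ) → ℝ} (hconv : ∀ x, ConvexOn ℝ (posSimplex Y) (φ x)) {u : ℝ}
    (hφ : ∀ (P : PMF X) (Q : PMF Y), (∀ y, Q y ≠ 0) →
      u ≤ ∑ x, (P x).toReal * φ x (fun y => (Q y).toReal) →
      fidelity α (joint P W) (prodDist P Q) ≤ s)
    (h : ∀ P : PMF X, ∃ Q : PMF Y, s < fidelity α (joint P W) (prodDist P Q)) :
    ∃ Q : PMF Y, (∀ y, Q y ≠ 0) ∧ ∀ x, φ x (fun y => (Q y).toReal) < u := by
  by_contra hcon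
  push Not at hcon
  have hne : (posSimplex Y).Nonempty :=
    ⟨_, PMF_toReal_mem_posSimplex (Q := PMF.uniformOfFintype Y) (by simp)⟩
  obtain ⟨p, hp, hp', hle⟩ := exists_weights_forall_le_sum hne hconv (t := u) fun q hq => by
    obtain ⟨x, hx⟩ := hcon (pmfOfReal q (fun y => (hq.1 y).le) hq.2) fun y => by
      simpa [pmfOfReal] using hq.1 y
    simp only [pmfOfReal_toReal] at hx
    exact ⟨x, hx⟩
  obtain ⟨Q, hQ⟩ := h (pmfOfReal p hp hp')
  refine absurd hQ (not_lt.2 (fidelity_prodDist_le_of_forall_fullSupport (fun Q hQ => ?_) Q))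
  refine hφ _ Q hQ ?_
  simp only [pmfOfReal_toReal]
  exact hle _ (PMF_toReal_mem_posSimplex hQ)

end Minimax

end MinimaxTheorem

-- Truncated channels and upper bounds on the simulation rate.

section Achievability

theorem nonempty_output {X Y : Type*} [Nonempty X] (W : Channel X Y) : Nonempty Y := by
  obtain ⟨x⟩ := ‹Nonempty X›
  exact ⟨(W x).support_nonempty.choose⟩

variable {X Y : Type*} [Fintype Y]

section Truncation

theorem ofReal_sum_rpow (W : Channel X Y) {Q : PMF Y} (hQ : ∀ y, Q y ≠ 0) {a : ℝ} (ha : 0 < a)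
    (x : X) : ∑ y, W x y ^ a * Q y ^ (1 - a) =
      ENNReal.ofReal (∑ y, (W x y).toReal ^ a * (Q y).toReal ^ (1 - a)) := by
  have hne : ∀ y, W x y ^ a * Q y ^ (1 - a) ≠ ∞ := fun y =>
    ENNReal.mul_ne_top (ENNReal.rpow_ne_top_of_nonneg ha.le ((W x).apply_ne_top y))
      (ENNReal.rpow_ne_top_of_ne_zero (hQ y) (Q.apply_ne_top y))
  rw [← ENNReal.ofReal_toReal (ENNReal.sum_ne_top.2 fun y _ => hne y),
    ENNReal.toReal_sum fun y _ => hne y]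
  simp only [ENNReal.toReal_mul, ENNReal.toReal_rpow]

/-- Truncating a channel so that it is dominated by a multiple of a constant channel. -/
theorem exists_truncation (W : Channel X Y) (Q : PMF Y) (A : ℝ≥0∞) :
    ∃ L : Channel X Y, (∀ x y, L x y ≤ (A + 1) * Q y) ∧
      ∀ x y, min (W x y) (A * Q y) ≤ L x y := by
  have hle : ∀ x, ∑ y, min (W x y) (A * Q y) ≤ 1 := fun x =>
    (Finset.sum_le_sum fun y _ => min_le_left _ _).trans (PMF_sum_coe (W x)).le
  -- The mass cut off is returned in proportion to `Q`, which raises the domination constant from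
  -- `A` to at most `A + 1`.
  refine ⟨fun x => PMF.ofFintype (fun y => min (W x y) (A * Q y) +
    (1 - ∑ y, min (W x y) (A * Q y)) * Q y) ?_, fun x y => ?_, fun x y => ?_⟩
  · rw [Finset.sum_add_distrib, ← Finset.mul_sum, PMF_sum_coe, mul_one,
      add_tsub_cancel_of_le (hle x)]
  · rw [PMF.ofFintype_apply, add_mul]
    gcongr
    · exact min_le_right _ _
    · exact tsub_le_self
  · rw [PMF.ofFintype_apply]
    exact le_self_add

/-- Untruncated letters contribute at most `W`, hence 1 in total; truncated ones at most `A^(1-a)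
W^a Q^(1-a)`, because `1 - a` is negative. -/
theorem one_add_rpow_le_fidelity [Fintype X] {a : ℝ} (ha : 1 < a) {W L : Channel X Y} {Q : PMF Y}
    {A ε : ℝ≥0∞} (hA : A ≠ ∞) (hL : ∀ x y, min (W x y) (A * Q y) ≤ L x y)
    (hε : ∀ x, A ^ (1 - a) * ∑ y, W x y ^ a * Q y ^ (1 - a) ≤ ε) (P : PMF X) :
    (1 + ε) ^ (1 / (1 - a)) ≤ fidelity (ENNReal.ofReal a) (joint P W) (joint P L) := by
  have ha0 : 0 < a := by linarith
  have h1a : 1 - a ≤ 0 := by linarith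
  rw [fidelity_ofReal ha0 ha.ne', sum_joint_rpow P W L ha0]
  refine ennreal_rpow_le_rpow_of_nonpos ?_ (one_div_nonpos.2 h1a)
  have key : ∀ x, ∑ y, W x y ^ a * L x y ^ (1 - a) ≤ 1 + ε := by
    intro x
    calc ∑ y, W x y ^ a * L x y ^ (1 - a)
        ≤ ∑ y, (W x y + A ^ (1 - a) * (W x y ^ a * Q y ^ (1 - a))) := by
          refine Finset.sum_le_sum fun y _ => ?_
          have hWt := (W x).apply_ne_top y
          rcases le_total (W x y) (A * Q y) with h | h
          · refine le_trans ?_ le_self_add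
            have hWL : W x y ≤ L x y := by simpa [h] using hL x y
            by_cases hW : W x y = 0
            · simp [hW, ENNReal.zero_rpow_of_pos ha0]
            · refine (mul_le_mul_right (ennreal_rpow_le_rpow_of_nonpos hWL h1a) _).trans ?_
              rw [← ENNReal.rpow_add _ _ hW hWt]
              simp
          · refine le_trans ?_ le_add_self
            have hQL : A * Q y ≤ L x y := by simpa [h] using hL x y
            refine (mul_le_mul_right (ennreal_rpow_le_rpow_of_nonpos hQL h1a) _).trans ?_
            rw [ENNReal.mul_rpow_of_ne_top hA (Q.apply_ne_top y), mul_left_comm]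
      _ ≤ 1 + ε := by
          rw [Finset.sum_add_distrib, PMF_sum_coe, ← Finset.mul_sum]
          gcongr
          exact hε x
  calc ∑ x, P x * ∑ y, W x y ^ a * L x y ^ (1 - a) ≤ ∑ x, P x * (1 + ε) :=
        Finset.sum_le_sum fun x _ => mul_le_mul_right (key x) _
    _ = 1 + ε := by rw [← Finset.sum_mul, PMF_sum_coe, one_mul]

end Truncation

theorem exists_lt_fidelity_of_renyiCapacity_lt [Fintype X] {α : ℝ≥0∞} {W : Channel X Y} {t : ℝ}
    (h : renyiCapacity α W < t) (P : PMF X) :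
    ∃ Q : PMF Y, ENNReal.ofReal (2 ^ (-t)) < fidelity α (joint P W) (prodDist P Q) := by
  obtain ⟨Q, hQ⟩ := iInf_lt_iff.1 ((le_iSup (fun P => renyiMutualInfo α P W) P).trans_lt h)
  exact ⟨Q, renyiDiv_lt_iff.1 hQ⟩

variable [Fintype X] [Nonempty X]

/-- The single-letter bound `hQ` multiplies over the letters, so truncating at `2 ^ (r n)` with `t <
r < R` leaves an error exponentially small in `n`. -/
theorem renyiSimulationRate_le_of_one_lt {α : ℝ≥0∞} {a t R : ℝ} (ha : 1 < a) (ht : 0 ≤ t)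
    (htR : t < R) {W : Channel X Y} {Q : PMF Y}
    (hα : ∀ (n : ℕ) (P : PMF (Fin n → X)) (M : Channel (Fin n → X) (Fin n → Y)),
      fidelity (ENNReal.ofReal a) (joint P (W.power n)) (joint P M) ≤
        fidelity α (joint P (W.power n)) (joint P M))
    (hQ : ∀ x, ∑ y, W x y ^ a * Q y ^ (1 - a) ≤ ENNReal.ofReal (2 ^ ((a - 1) * t))) :
    renyiSimulationRate α W ≤ R := by
  obtain ⟨r, htr, hrR⟩ := exists_between htR
  have ha0 : 0 < a := by linarith
  have hr1 : (1 : ℝ) ≤ 2 ^ r := Real.one_le_rpow one_le_two (by linarith)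
  have hrn : ∀ n : ℕ, (1 : ℝ) ≤ (2 ^ r) ^ n := fun n => one_le_pow₀ hr1
  choose L hL hL' using fun n : ℕ =>
    exists_truncation (W.power n) (iid Q n) (ENNReal.ofReal ((2 ^ r) ^ n))
  set ε : ℝ≥0∞ := ENNReal.ofReal (2 ^ ((a - 1) * (t - r))) with hε
  have hε1 : ε < 1 := by
    rw [hε, ENNReal.ofReal_lt_one]
    exact Real.rpow_lt_one_of_one_lt_of_neg one_lt_two
      (mul_neg_of_pos_of_neg (by linarith) (by linarith))
  refine renyiSimulationRate_le_of_forall (a := 2 ^ r) (θ := fun n => (1 + ε ^ n) ^ (1 / (1 - a)))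
    hr1 (Real.rpow_lt_rpow_of_exponent_lt one_lt_two hrR) (fun n => iid Q n) L (fun n x y => ?_) ?_
    fun n P => ?_
  · refine (hL n x y).trans (mul_le_mul_left ?_ _)
    rw [← ENNReal.ofReal_one, ← ENNReal.ofReal_add (by positivity) zero_le_one]
    exact ENNReal.ofReal_le_ofReal (by linarith [hrn n])
  · have h1 := (ENNReal.tendsto_pow_atTop_nhds_zero_of_lt_one hε1).const_add 1
    rw [add_zero] at h1
    have h2 := (ENNReal.continuous_rpow_const (y := 1 / (1 - a))).tendsto 1
    rw [ENNReal.one_rpow] at h2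
    exact h2.comp h1
  · refine (one_add_rpow_le_fidelity ha ENNReal.ofReal_ne_top (hL' n) (fun x => ?_) P).trans
      (hα n P (L n))
    have hprod : ∑ y, W.power n x y ^ a * iid Q n y ^ (1 - a) =
        ∏ i, ∑ y, W (x i) y ^ a * Q y ^ (1 - a) := by
      rw [Fintype.prod_sum]
      refine Finset.sum_congr rfl fun y _ => ?_
      rw [Channel.power_apply, iid_apply, ← ENNReal.prod_rpow_of_nonneg ha0.le,
        ← ENNReal.prod_rpow_of_ne_top fun i _ => Q.apply_ne_top _, Finset.prod_mul_distrib]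
    calc ENNReal.ofReal ((2 ^ r) ^ n) ^ (1 - a) * ∑ y, W.power n x y ^ a * iid Q n y ^ (1 - a)
        ≤ ENNReal.ofReal ((2 ^ r) ^ n) ^ (1 - a) * ENNReal.ofReal (2 ^ ((a - 1) * t)) ^ n := by
          rw [hprod]
          gcongr
          refine (Finset.prod_le_prod' fun i _ => hQ (x i)).trans ?_
          simp
      _ = ε ^ n := by
          rw [ENNReal.ofReal_rpow_of_pos (by positivity), ← ENNReal.ofReal_pow (by positivity),
            ← ENNReal.ofReal_pow (by positivity), ← ENNReal.ofReal_mul (by positivity)]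
          congr 1
          simp only [← Real.rpow_mul_natCast zero_le_two, ← Real.rpow_mul zero_le_two,
            ← Real.rpow_add two_pos]
          congr 1
          ring

theorem renyiCapacity_nonneg (α : ℝ≥0∞) (W : Channel X Y) : 0 ≤ renyiCapacity α W := by
  obtain ⟨x⟩ := ‹Nonempty X›
  exact le_iSup_of_le (PMF.pure x) (le_iInf fun Q => renyiDiv_joint_nonneg α _ W fun _ => Q)

theorem shannonCapacity_nonneg (W : Channel X Y) : 0 ≤ shannonCapacity W := by
  obtain ⟨x⟩ := ‹Nonempty X›
  exact le_iSup_of_le (PMF.pure x) (renyiDiv_joint_nonneg 1 _ W fun _ => (PMF.pure x).bind W)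

theorem renyiSimulationRate_le_renyiCapacity_of_one_lt {a : ℝ} (ha : 1 < a) (W : Channel X Y) :
    renyiSimulationRate (ENNReal.ofReal a) W ≤ renyiCapacity (ENNReal.ofReal a) W := by
  have := nonempty_output W
  refine EReal.le_of_forall_lt_iff_le.1 fun R hR => ?_
  obtain ⟨t, ht, htR⟩ := EReal.exists_between_coe_real hR
  have ht0 : (0 : ℝ) ≤ t := by exact_mod_cast (renyiCapacity_nonneg _ W).trans ht.le
  have ha0 : 0 < a := by linarith
  obtain ⟨Q, hQ, hlt⟩ : ∃ Q : PMF Y, (∀ y, Q y ≠ 0) ∧ ∀ x,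
      ∑ y, (W x y).toReal ^ a * (Q y).toReal ^ (1 - a) < 2 ^ ((a - 1) * t) := by
    refine exists_fullSupport_forall_lt (α := ENNReal.ofReal a) (W := W)
      (φ := fun x q => ∑ y, (W x y).toReal ^ a * q y ^ (1 - a)) (u := 2 ^ ((a - 1) * t))
      (fun x => convexOn_posSimplex_sum fun y =>
        (convexOn_rpow_of_nonpos (by linarith)).smul (Real.rpow_nonneg ENNReal.toReal_nonneg a))
      (fun P Q hQ hle => ?_) (exists_lt_fidelity_of_renyiCapacity_lt ht)
    rw [prodDist_eq_joint, fidelity_ofReal ha0 ha.ne', sum_joint_rpow P W _ ha0]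
    have h1 : ENNReal.ofReal (2 ^ ((a - 1) * t)) ≤
        ∑ x, P x * ∑ y, W x y ^ a * Q y ^ (1 - a) := by
      refine (ENNReal.ofReal_le_ofReal hle).trans (le_of_eq ?_)
      have hnn : ∀ x, 0 ≤ ∑ y, (W x y).toReal ^ a * (Q y).toReal ^ (1 - a) := fun x =>
        Finset.sum_nonneg fun y _ => mul_nonneg (Real.rpow_nonneg ENNReal.toReal_nonneg _)
          (Real.rpow_nonneg ENNReal.toReal_nonneg _)
      rw [ENNReal.ofReal_sum_of_nonneg fun x _ => mul_nonneg ENNReal.toReal_nonneg (hnn x)]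
      refine Finset.sum_congr rfl fun x _ => ?_
      rw [ENNReal.ofReal_mul ENNReal.toReal_nonneg, ENNReal.ofReal_toReal (P.apply_ne_top x),
        ofReal_sum_rpow W hQ ha0]
    refine (ennreal_rpow_le_rpow_of_nonpos h1 (one_div_nonpos.2 (by linarith))).trans ?_
    rw [ENNReal.ofReal_rpow_of_pos (by positivity), ← Real.rpow_mul zero_le_two]
    refine ENNReal.ofReal_le_ofReal (le_of_eq ?_)
    congr 1
    have : 1 - a ≠ 0 := by linarith
    field_simp
    ring
  refine renyiSimulationRate_le_of_one_lt ha ht0 (by exact_mod_cast htR) (Q := Q)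
    (fun n P M => le_rfl) fun x => ?_
  rw [ofReal_sum_rpow W hQ ha0]
  exact ENNReal.ofReal_le_ofReal (hlt x).le

theorem renyiSimulationRate_top_le (W : Channel X Y) :
    renyiSimulationRate ∞ W ≤ renyiCapacity ∞ W := by
  refine EReal.le_of_forall_lt_iff_le.1 fun R hR => ?_
  obtain ⟨t, ht, htR⟩ := EReal.exists_between_coe_real hR
  have ht0 : (0 : ℝ) ≤ t := by exact_mod_cast (renyiCapacity_nonneg _ W).trans ht.le
  -- At order `∞` only the support of the input distribution matters, so a uniform input gives a `Q`
  -- good for all letters without minimax.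
  obtain ⟨Q, hQ⟩ := exists_lt_fidelity_of_renyiCapacity_lt ht (PMF.uniformOfFintype X)
  have hWQ : ∀ x y, W x y ≤ ENNReal.ofReal (2 ^ t) * Q y := by
    intro x y
    have h1 := (mul_le_mul_left hQ.le _).trans
      (fidelity_top_prodDist_mul_le (PMF.uniformOfFintype X) W Q (x := x) (by simp) y)
    calc W x y = ENNReal.ofReal (2 ^ t) * (ENNReal.ofReal (2 ^ (-t)) * W x y) := by
          rw [← mul_assoc, ← ENNReal.ofReal_mul (by positivity), ← Real.rpow_add two_pos]
          simp
      _ ≤ _ := mul_le_mul_right h1 _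
  refine renyiSimulationRate_le_of_forall (a := 2 ^ t) (θ := fun _ => 1)
    (Real.one_le_rpow one_le_two ht0)
    (Real.rpow_lt_rpow_of_exponent_lt one_lt_two (by exact_mod_cast htR)) (fun n => iid Q n)
    (fun n => W.power n) (fun n x y => ?_) tendsto_const_nhds fun n P => ?_
  · rw [Channel.power_apply, iid_apply]
    refine (Finset.prod_le_prod' fun i _ => hWQ (x i) (y i)).trans ?_
    rw [Finset.prod_mul_distrib, Finset.prod_const, Finset.card_univ, Fintype.card_fin,
      ← ENNReal.ofReal_pow (by positivity)]
    refine mul_le_mul_left (ENNReal.ofReal_le_ofReal ?_) _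
    have : (0 : ℝ) < (2 ^ t) ^ n := by positivity
    linarith
  · rw [fidelity_top]
    exact le_iInf₂ fun p hp => (ENNReal.div_self hp (joint_ne_top _ _ _)).ge

theorem renyiSimulationRate_zero_le (W : Channel X Y) :
    renyiSimulationRate 0 W ≤ renyiCapacity 0 W := by
  classical
  have := nonempty_output W
  refine EReal.le_of_forall_lt_iff_le.1 fun R hR => ?_
  obtain ⟨t, ht, htR⟩ := EReal.exists_between_coe_real hR
  have ht0 : (0 : ℝ) ≤ t := by exact_mod_cast (renyiCapacity_nonneg _ W).trans ht.le
  have hmass : ∀ (Q : PMF Y) (x : X), ∑ y, (Function.support (W x)).indicator Q y =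
      ENNReal.ofReal (∑ y, (if W x y = 0 then 0 else 1) * (Q y).toReal) := by
    intro Q x
    rw [ENNReal.ofReal_sum_of_nonneg fun y _ => by split_ifs <;> simp]
    refine Finset.sum_congr rfl fun y _ => ?_
    by_cases hW : W x y = 0 <;> simp [hW, ENNReal.ofReal_toReal (Q.apply_ne_top y)]
  obtain ⟨Q, -, hlt⟩ : ∃ Q : PMF Y, (∀ y, Q y ≠ 0) ∧ ∀ x,
      ∑ y, (if W x y = 0 then 0 else -1) * (Q y).toReal < -2 ^ (-t) := by
    -- The order-0 fidelity is to be bounded from below, so its negative is fed to the minimax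
    -- lemma.
    refine exists_fullSupport_forall_lt (α := 0) (W := W)
      (φ := fun x q => ∑ y, (if W x y = 0 then 0 else -1) * q y) (u := -2 ^ (-t))
      (fun x => convexOn_posSimplex_sum fun y => by
        refine ⟨convex_Ioi 0, fun u _ v _ a b _ _ _ => le_of_eq ?_⟩
        simp only [smul_eq_mul]
        ring)
      (fun P Q hQ hle => ?_) (exists_lt_fidelity_of_renyiCapacity_lt ht)
    rw [prodDist_eq_joint, fidelity_zero_joint]
    simp only [hmass]
    calc ∑ x, P x * ENNReal.ofReal (∑ y, (if W x y = 0 then 0 else 1) * (Q y).toReal)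
        = ENNReal.ofReal (∑ x, (P x).toReal * ∑ y, (if W x y = 0 then 0 else 1) * (Q y).toReal) := by
          rw [ENNReal.ofReal_sum_of_nonneg fun x _ => mul_nonneg ENNReal.toReal_nonneg
            (Finset.sum_nonneg fun y _ => by split_ifs <;> simp)]
          refine Finset.sum_congr rfl fun x _ => ?_
          rw [ENNReal.ofReal_mul ENNReal.toReal_nonneg, ENNReal.ofReal_toReal (P.apply_ne_top x)]
      _ ≤ _ := by
          refine ENNReal.ofReal_le_ofReal ?_
          rw [neg_le, ← Finset.sum_neg_distrib] at hle
          refine le_trans (le_of_eq (Finset.sum_congr rfl fun x _ => ?_)) hle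
          rw [← mul_neg, ← Finset.sum_neg_distrib]
          congr 1
          refine Finset.sum_congr rfl fun y _ => ?_
          split_ifs <;> ring
  have hv : ∀ x, ENNReal.ofReal (2 ^ (-t)) ≤ ∑ y, (Function.support (W x)).indicator Q y := by
    intro x
    rw [hmass]
    refine ENNReal.ofReal_le_ofReal ?_
    have h1 := (hlt x).le
    rw [le_neg, ← Finset.sum_neg_distrib] at h1
    refine h1.trans (le_of_eq (Finset.sum_congr rfl fun y _ => ?_))
    split_ifs <;> ring
  have hvn : ∀ n (x : Fin n → X), (ENNReal.ofReal ((2 ^ t) ^ n))⁻¹ ≤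
      ∑ y, (Function.support (W.power n x)).indicator (iid Q n) y := by
    intro n x
    have hprod : ∑ y, (Function.support (W.power n x)).indicator (iid Q n) y =
        ∏ i, ∑ y, (Function.support (W (x i))).indicator Q y := by
      rw [Fintype.prod_sum]
      refine Finset.sum_congr rfl fun y _ => ?_
      by_cases h : W.power n x y = 0
      · rw [Set.indicator_of_notMem (by simpa using h)]
        rw [Channel.power_apply] at h
        obtain ⟨i, hi, h0⟩ := Finset.prod_eq_zero_iff.1 h
        exact (Finset.prod_eq_zero (i := i) hi (by
          rw [Set.indicator_of_notMem (by simpa using h0)])).symm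
      · rw [Set.indicator_of_mem (by simpa using h), iid_apply]
        rw [Channel.power_apply] at h
        refine Finset.prod_congr rfl fun i hi => ?_
        rw [Set.indicator_of_mem]
        exact Finset.prod_ne_zero_iff.1 h i hi
    rw [hprod, ← ENNReal.ofReal_inv_of_pos (by positivity), ← inv_pow, ← Real.rpow_neg zero_le_two,
      ENNReal.ofReal_pow (by positivity)]
    calc ENNReal.ofReal (2 ^ (-t)) ^ n = ∏ _i : Fin n, ENNReal.ofReal (2 ^ (-t)) := by simp
      _ ≤ _ := Finset.prod_le_prod' fun i _ => hv (x i)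
  set S : ∀ n, (Fin n → X) → ℝ≥0∞ := fun n x =>
    ∑ y, (Function.support (W.power n x)).indicator (iid Q n) y with hS
  have hS0 : ∀ n x, S n x ≠ 0 := fun n x h0 => by
    have := hvn n x
    rw [show ∑ y, (Function.support (W.power n x)).indicator (iid Q n) y = 0 from h0] at this
    simp at this
  have hSt : ∀ n x, S n x ≠ ∞ := fun n x => ENNReal.sum_ne_top.2 fun y _ => by
    rw [Set.indicator_apply]
    split_ifs
    · exact (iid Q n).apply_ne_top y
    · exact ENNReal.zero_ne_top
  have hone : ∀ n x, ∑ y, (S n x)⁻¹ * (Function.support (W.power n x)).indicator (iid Q n) y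
      = 1 := fun n x => by
    rw [← Finset.mul_sum]
    exact ENNReal.inv_mul_cancel (hS0 n x) (hSt n x)
  refine renyiSimulationRate_le_of_forall (a := 2 ^ t) (θ := fun _ => 1)
    (Real.one_le_rpow one_le_two ht0)
    (Real.rpow_lt_rpow_of_exponent_lt one_lt_two (by exact_mod_cast htR)) (fun n => iid Q n)
    (fun n x => PMF.ofFintype _ (hone n x)) (fun n x y => ?_) tendsto_const_nhds fun n P => ?_
  · rw [PMF.ofFintype_apply]
    have hpos : (0 : ℝ) < (2 ^ t) ^ n := by positivity
    refine mul_le_mul' ?_ (Set.indicator_le_self _ _ y)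
    refine (ENNReal.inv_le_iff_inv_le.1 (hvn n x)).trans (ENNReal.ofReal_le_ofReal ?_)
    linarith
  · rw [fidelity_zero_joint]
    have : ∀ x, ∑ y, (Function.support (W.power n x)).indicator
        (PMF.ofFintype _ (hone n x)) y = 1 := by
      intro x
      rw [← hone n x]
      refine Finset.sum_congr rfl fun y _ => ?_
      by_cases h : y ∈ Function.support (W.power n x)
      · rw [Set.indicator_of_mem h, PMF.ofFintype_apply]
      · rw [Set.indicator_of_notMem h, Set.indicator_of_notMem h, mul_zero]
    simp only [this, mul_one, PMF_sum_coe, le_refl]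

theorem renyiSimulationRate_le_shannonCapacity {α : ℝ≥0∞} (hα : 0 < α) (hα' : α ≤ 1)
    (W : Channel X Y) : renyiSimulationRate α W ≤ shannonCapacity W := by
  have := nonempty_output W
  refine EReal.le_of_forall_lt_iff_le.1 fun R hR => ?_
  obtain ⟨t, ht, htR⟩ := EReal.exists_between_coe_real hR
  have ht0 : (0 : ℝ) ≤ t := by exact_mod_cast (shannonCapacity_nonneg W).trans ht.le
  obtain ⟨Q, hQ, hlt⟩ : ∃ Q : PMF Y, (∀ y, Q y ≠ 0) ∧ ∀ x, ∑ y, (W x y).toReal *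
      (Real.log (W x y).toReal - Real.log (Q y).toReal) < t * Real.log 2 := by
    refine exists_fullSupport_forall_lt (α := 1) (W := W)
      (φ := fun x q => ∑ y, (W x y).toReal * (Real.log (W x y).toReal - Real.log (q y)))
      (u := t * Real.log 2) (s := ENNReal.ofReal (2 ^ (-t)))
      (fun x => convexOn_posSimplex_sum fun y =>
        ((convexOn_const _ (convex_Ioi 0)).sub strictConcaveOn_log_Ioi.concaveOn).smul
          ENNReal.toReal_nonneg)
      -- The output distribution serves as `Q`, so no minimization over `Q` is needed at order 1.
      (fun P Q hQ hle => ?_) fun P => ⟨P.bind W, renyiDiv_lt_iff.1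
        ((le_iSup (fun P => mutualInfo P W) P).trans_lt ht)⟩
    rw [prodDist_eq_joint, fidelity_one_joint_eq_exp P W _ fun x y _ h => absurd h (hQ y),
      ofReal_two_rpow_neg]
    exact ENNReal.ofReal_le_ofReal (Real.exp_le_exp.2 (neg_le_neg hle))
  -- The derivative of this sum at 1 is the relative entropy of `W x` and `Q` in nats, so a strict
  -- bound at order 1 persists slightly above it; finiteness of `X` gives a common `b`.
  have hev : ∀ x, ∀ᶠ b in 𝓝[>] (1 : ℝ), ∑ y, (W x y).toReal ^ b * (Q y).toReal ^ (1 - b) <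
      Real.exp (t * Real.log 2 * (b - 1)) := by
    intro x
    refine eventually_lt_exp_right (f := fun b => ∑ y, (W x y).toReal ^ b * (Q y).toReal ^ (1 - b))
      (J := ∑ y, (W x y).toReal * (Real.log (W x y).toReal - Real.log (Q y).toReal))
      (HasDerivAt.fun_sum fun y _ => ?_) ?_ (hlt x)
    · have hq := ENNReal.toReal_pos (hQ y) (Q.apply_ne_top y)
      have h1 := hasDerivAt_const_rpow_one (w := (W x y).toReal) ENNReal.toReal_nonneg
      have h2 : HasDerivAt (fun b : ℝ => (Q y).toReal ^ (1 - b)) (-Real.log (Q y).toReal) 1 := by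
        have h3 := ((hasDerivAt_id (1 : ℝ)).const_sub 1).const_rpow hq
        exact h3.congr_deriv (by simp)
      refine (h1.fun_mul h2).congr_deriv ?_
      simp only [sub_self, Real.rpow_zero, Real.rpow_one]
      ring
    · simpa using sum_toReal_eq_one (PMF_sum_coe (W x))
  obtain ⟨b, hb, hb1⟩ := ((eventually_all.2 hev).and self_mem_nhdsWithin).exists
  have hb1' : 1 < b := hb1
  refine renyiSimulationRate_le_of_one_lt hb1' ht0 (by exact_mod_cast htR) (Q := Q)
    (fun n P M => ?_) fun x => ?_
  · refine (fidelity_le_fidelity_one (sum_joint _ _) (joint_ne_top _ _) hb1').trans ?_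
    rcases hα'.eq_or_lt with rfl | h1
    · exact le_rfl
    · have hαt : α ≠ ∞ := (h1.trans ENNReal.one_lt_top).ne
      rw [← ENNReal.ofReal_toReal hαt]
      refine fidelity_one_le_of_lt_one (sum_joint _ _) (joint_ne_top _ _)
        (ENNReal.toReal_pos hα.ne' hαt) ?_
      rw [← ENNReal.toReal_one]
      exact (ENNReal.toReal_lt_toReal hαt ENNReal.one_ne_top).2 h1
  · rw [ofReal_sum_rpow W hQ (by linarith)]
    refine ENNReal.ofReal_le_ofReal ((hb x).le.trans (le_of_eq ?_))
    rw [Real.rpow_def_of_pos two_pos]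
    congr 1
    ring

end Achievability

end ReverseShannon

end

theorem theorem1 {X Y : Type*} [Fintype X] [Nonempty X] [Fintype Y]
    (W : ReverseShannon.Channel X Y) (α : ENNReal) :
    (0 < α ∧ α ≤ 1 →
      ReverseShannon.renyiSimulationRate α W = ReverseShannon.shannonCapacity W) ∧
    (α = 0 ∨ 1 < α →
      ReverseShannon.renyiSimulationRate α W = ReverseShannon.renyiCapacity α W) := by
  refine ⟨fun h => le_antisymm (ReverseShannon.renyiSimulationRate_le_shannonCapacity h.1 h.2 W)
    (ReverseShannon.shannonCapacity_le_renyiSimulationRate h.1 h.2 W), fun h => le_antisymm ?_ ?_⟩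
  · rcases ReverseShannon.order_cases α with rfl | rfl | rfl | ⟨a, ha, -, rfl⟩
    · exact ReverseShannon.renyiSimulationRate_zero_le W
    · simp at h
    · exact ReverseShannon.renyiSimulationRate_top_le W
    · refine ReverseShannon.renyiSimulationRate_le_renyiCapacity_of_one_lt ?_ W
      rcases h with h | h
      · exact absurd (ENNReal.ofReal_eq_zero.1 h) (not_le.2 ha)
      · exact ENNReal.one_lt_ofReal.1 h
  · refine ReverseShannon.renyiCapacity_le_renyiSimulationRate ?_ W
    rintro rfl
    simp at h
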